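/- **Theorem A.** For $n=1,2,3,\dots$ let $A_n$ be the number of domino tilings of the $2n\times 2n$ board (equivalently, of perfect matchings of the $2n\times 2n$ square lattice graph). Then $A_n=2^n B_n^2$ for a (unique) positive integer $B_n$. For an integer $r\ge 0$ let $\mathbb S_r$ be the statement that, for every $n\ge 1$, $$B_n\equiv\begin{cases} n+1 \pmod{2^r} & \text{if } n \text{ is even},\\ (-1)^{(n-1)/2}\,n \pmod{2^r} & \text{if } n \text{ is odd}.\end{cases}$$ Then $\mathbb S_5$ is true (thus also $\mathbb S_r$ for all $r\le 5$), and $\mathbb S_6$ is false (thus also $\mathbb S_r$ for all $r\ge 6$). Moreover $B_3=29$, which is a counterexample to $\mathbb S_6$, since $29\not\equiv-3\pmod{64}$. -/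

import Mathlib

/-- The `m × m` square lattice graph: its vertices are the squares of the `m × m` chessboard, and
two of them are adjacent iff the squares share a side. -/
def squareLattice (m : ℕ) : SimpleGraph (Fin m × Fin m) :=
  SimpleGraph.boxProd (SimpleGraph.pathGraph m) (SimpleGraph.pathGraph m)

/-- `A_n`: the number of coverings of the `2n × 2n` chessboard by dominoes, that is, of perfect
matchings (dimer coverings) of the `2n × 2n` square lattice graph. -/
noncomputable def tilingCount (n : ℕ) : ℕ :=
  Set.ncard {M : (squareLattice (2 * n)).Subgraph | M.IsPerfectMatching}

/-- The statement `S_r` about a sequence `B`: for every `n ≥ 1`, modulo `2 ^ r`, `B n` is congruent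
to `n + 1` if `n` is even and to `(-1) ^ ((n - 1) / 2) * n` if `n` is odd. -/
def CongruenceStatement (B : ℕ → ℤ) (r : ℕ) : Prop :=
  ∀ n : ℕ, 1 ≤ n →
    (Even n → B n ≡ (n : ℤ) + 1 [ZMOD 2 ^ r]) ∧
    (Odd n → B n ≡ (-1) ^ ((n - 1) / 2) * (n : ℤ) [ZMOD 2 ^ r])

/-! Write `c_j = 2 cos(2πj/(2n+1))`. The number of tilings is found from two computations of the
determinant of Kasteleyn's signed adjacency matrix `K`. Combinatorially, a permutation with nonzero
contribution moves every square to a neighbour. As the board is bipartite, such a permutation is the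
same as an ordered pair of tilings (`pairingPairsEquiv`). Flips of 2 × 2 blocks preserve the
contribution and connect all tilings, so `|det K| = A_n²`
(`abs_det_kasteleynMatrix_eq_tilingCount_sq`). Spectrally, `K² = P² ⊗ 1 + 1 ⊗ P²` for the path
matrix `P`, whose squared eigenvalues are `2 + c_k`. Hence `(det K)² = ∏ (4 + c_k + c_l)` over `1 ≤
k, l ≤ 2n`. Since `c_{2n+1-k} = c_k`, this is the fourth power of the product over `k, l ≤ n`. There
the diagonal gives `2^n ∏ (2 + c_k) = 2^n` and the rest is the square of `B = ∏_{a<b} (4 + c_a +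
c_b)`. So `A_n = 2^n B²`. The substitution `(j, k) ↦ (j + k, j - k)` on residues modulo `2n+1`, with
`c_j c_k = c_{j+k} + c_{j-k}`, turns `B` into `∏_{a<b} (4 + c_a c_b)` (`prod_pairs_chord_add`). Up
to sign this is `∏_{a<b} (1 + 4 x_a x_b)` with `x_a = -1/c_a`, which equals `1 + 4e₂ + 16(e₁e₃ -
e₄)` plus 64 times an integral symmetric polynomial in the `x_a`. The `e_k` are integers: up to a
common sign they are the coefficients of the integer polynomial with roots `c_a`, whose constant
term is `±1`. Its five lowest coefficients are signed binomials (`chordPoly_coeffs`), so the residue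
of `B` modulo 32 comes down to a check of period 16 in `⌊n/2⌋`. For modulus 64 the value at `n = 3`
refutes the pattern. -/

/-! ### Products over pairs modulo 64 and symmetric functions -/

open Polynomial in
theorem coeff_zero_prod_one_add {S : Type*} [CommRing S] {n : ℕ} (x : Fin n → S) :
    (∏ i, (1 + C (x i) * X)).coeff 0 = 1 := by
  simp [coeff_zero_eq_eval_zero, eval_prod]

open Polynomial in
theorem coeff_succ_prod_one_add {S : Type*} [CommRing S] {n : ℕ} (x : Fin (n + 1) → S) (k : ℕ) :
    (∏ i, (1 + C (x i) * X)).coeff (k + 1) =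
      (∏ i : Fin n, (1 + C (x i.succ) * X)).coeff (k + 1) +
        x 0 * (∏ i : Fin n, (1 + C (x i.succ) * X)).coeff k := by
  rw [Fin.prod_univ_succ, add_mul, one_mul, coeff_add, mul_assoc, coeff_C_mul, coeff_X_mul]

-- This is the factor that one new variable `t` contributes, paired with all the old ones, in the
-- induction for `prod_pairs_expansion`.
open Polynomial in
theorem prod_one_add_four_mul_expansion {S : Type*} [CommRing S] {n : ℕ} (t : S) (y : Fin n → S) :
    ∃ Q : S, ∏ j, (1 + 4 * (t * y j)) =
      1 + 4 * t * (∏ i, (1 + C (y i) * X)).coeff 1 +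
        16 * t ^ 2 * (∏ i, (1 + C (y i) * X)).coeff 2 + 64 * Q := by
  induction n with
  | zero => exact ⟨0, by simp [coeff_one]⟩
  | succ m ih =>
    obtain ⟨Q, hQ⟩ := ih (fun i => y i.succ)
    have h0 := coeff_zero_prod_one_add (fun i => y i.succ)
    rw [Fin.prod_univ_succ, hQ, coeff_succ_prod_one_add, coeff_succ_prod_one_add, h0]
    exact ⟨Q * (1 + 4 * (t * y 0)) +
      t ^ 2 * y 0 * t * (∏ i : Fin m, (1 + C (y i.succ) * X)).coeff 2, by ring⟩

open Polynomial in
/-- The product of `1 + 4 x_i x_j` over the pairs `i < j`, modulo `64`, in terms of the elementary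
symmetric functions of the `x_i`. -/
theorem prod_pairs_expansion {S : Type*} [CommRing S] {n : ℕ} (x : Fin n → S) :
    ∃ R : S, ∏ i, ∏ j ∈ Finset.Ioi i, (1 + 4 * (x i * x j)) =
      1 + 4 * (∏ i, (1 + C (x i) * X)).coeff 2 +
        16 * ((∏ i, (1 + C (x i) * X)).coeff 1 * (∏ i, (1 + C (x i) * X)).coeff 3 -
          (∏ i, (1 + C (x i) * X)).coeff 4) + 64 * R := by
  induction n with
  | zero => exact ⟨0, by simp [coeff_one]⟩
  | succ n ih =>
    obtain ⟨R, hR⟩ := ih (fun i => x i.succ)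
    obtain ⟨Q, hQ⟩ := prod_one_add_four_mul_expansion (x 0) (fun i => x i.succ)
    have h0 := coeff_zero_prod_one_add (fun i => x i.succ)
    rw [Fin.prod_univ_succ, Fin.prod_Ioi_zero]
    simp only [Fin.prod_Ioi_succ]
    rw [hR, hQ]
    simp only [coeff_succ_prod_one_add, h0]
    generalize (∏ i : Fin n, (1 + C (x i.succ) * X)) = p
    set a := x 0
    -- The witness collects the terms of the product of both expansions that are divisible by 64.
    refine ⟨Q * (1 + 4 * p.coeff 2 + 16 * (p.coeff 1 * p.coeff 3 - p.coeff 4) + 64 * R) +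
      R * (1 + 4 * a * p.coeff 1 + 16 * a ^ 2 * p.coeff 2) +
      (a * p.coeff 1 + 4 * a ^ 2 * p.coeff 2) * (p.coeff 1 * p.coeff 3 - p.coeff 4) +
      a ^ 2 * p.coeff 2 * p.coeff 2, ?_⟩
    ring

/-- A permutation need not preserve `i < j`, so the bijection sorts the image of each pair; symmetry
of `g` absorbs the sorting. -/
theorem prod_pairs_comp_perm {M : Type*} [CommMonoid M] {n : ℕ} (σ : Equiv.Perm (Fin n))
    (g : Fin n → Fin n → M) (hg : ∀ i j, g i j = g j i) :
    ∏ i, ∏ j ∈ Finset.Ioi i, g (σ i) (σ j) = ∏ i, ∏ j ∈ Finset.Ioi i, g i j := by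
  rw [Finset.prod_sigma', Finset.prod_sigma']
  refine Finset.prod_bij'
    (fun p _ => ⟨min (σ p.1) (σ p.2), max (σ p.1) (σ p.2)⟩)
    (fun p _ => ⟨min (σ.symm p.1) (σ.symm p.2), max (σ.symm p.1) (σ.symm p.2)⟩) ?_ ?_ ?_ ?_ ?_
  · rintro ⟨i, j⟩ h
    have : i < j := by simpa using h
    simpa using this.ne'
  · rintro ⟨i, j⟩ h
    have : i < j := by simpa using h
    simpa using this.ne'
  · rintro ⟨i, j⟩ h
    have h' : i < j := by simpa using h
    rcases le_total (σ i) (σ j) with h1 | h1 <;> simp [h1, h'.le]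
  · rintro ⟨i, j⟩ h
    have h' : i < j := by simpa using h
    rcases le_total (σ.symm i) (σ.symm j) with h1 | h1 <;> simp [h1, h'.le]
  · rintro ⟨i, j⟩ h
    rcases le_total (σ i) (σ j) with h1 | h1 <;> simp [h1, hg (σ i)]

open Polynomial in
theorem coeff_prod_one_add_eq_sum {S : Type*} [CommRing S] {n : ℕ} (x : Fin n → S) (k : ℕ) :
    (∏ i, (1 + C (x i) * X)).coeff k =
      ∑ t ∈ Finset.powersetCard k Finset.univ, ∏ i ∈ t, x i := by
  rw [Finset.prod_one_add, finsetSum_coeff, Finset.powersetCard_eq_filter, Finset.sum_filter]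
  refine Finset.sum_congr rfl fun t _ => ?_
  rw [Finset.prod_mul_distrib, Finset.prod_const, ← map_prod, coeff_C_mul, coeff_X_pow]
  simp [eq_comm]

open Polynomial in
theorem coeff_prod_one_add_X_eq_esymm {n : ℕ} (k : ℕ) :
    (∏ i : Fin n, (1 + C (MvPolynomial.X i : MvPolynomial (Fin n) ℤ) * X)).coeff k =
      MvPolynomial.esymm (Fin n) ℤ k :=
  coeff_prod_one_add_eq_sum _ k

open Polynomial in
theorem aeval_esymm_eq_coeff {S : Type*} [CommRing S] {n : ℕ} (x : Fin n → S) (k : ℕ) :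
    MvPolynomial.aeval x (MvPolynomial.esymm (Fin n) ℤ k) = (∏ i, (1 + C (x i) * X)).coeff k := by
  simp [coeff_prod_one_add_eq_sum, MvPolynomial.esymm, map_sum, map_prod]

open Polynomial in
/-- A symmetric integer polynomial takes integer values at points whose elementary symmetric
functions are integers. -/
theorem exists_int_of_isSymmetric {S : Type*} [CommRing S] {n : ℕ} (x : Fin n → S) (V : ℤ[X])
    (hV : ∏ i, (1 + C (x i) * X) = V.map (Int.castRingHom S))
    (R : MvPolynomial (Fin n) ℤ) (hR : R.IsSymmetric) :
    ∃ z : ℤ, MvPolynomial.aeval x R = (z : S) := by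
  obtain ⟨q, hq⟩ := MvPolynomial.esymmAlgHom_fin_surjective ℤ (le_refl n)
    ⟨R, (MvPolynomial.mem_symmetricSubalgebra R).2 hR⟩
  have hq' := congrArg Subtype.val hq
  rw [MvPolynomial.esymmAlgHom_apply] at hq'
  dsimp only at hq'
  rw [← hq']
  -- `R` is a polynomial `q` in the elementary symmetric functions, whose values are the
  -- coefficients of `V`. The index is shifted because variable `i` of `q` stands for `e_{i+1}`.
  refine ⟨MvPolynomial.aeval (fun i : Fin n => V.coeff (i + 1)) q, ?_⟩
  clear hq hq'
  induction q using MvPolynomial.induction_on with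
  | C a => simp
  | add p q hp hq => rw [map_add, map_add, map_add, hp, hq, Int.cast_add]
  | mul_X p i hp =>
    rw [map_mul, map_mul, map_mul, hp, MvPolynomial.aeval_X, MvPolynomial.aeval_X,
      aeval_esymm_eq_coeff, hV, coeff_map, Int.cast_mul, eq_intCast]

-- The expansion is used first for indeterminates: there 64 can be cancelled, so the remainder
-- inherits symmetry from the other terms and takes an integer value at `x`.
open Polynomial in
theorem prod_pairs_eq_int {S : Type*} [CommRing S] {n : ℕ} (x : Fin n → S) (V : ℤ[X])
    (hV : ∏ i, (1 + C (x i) * X) = V.map (Int.castRingHom S)) :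
    ∃ z : ℤ, ∏ i, ∏ j ∈ Finset.Ioi i, (1 + 4 * (x i * x j)) =
      ((1 + 4 * V.coeff 2 + 16 * (V.coeff 1 * V.coeff 3 - V.coeff 4) + 64 * z : ℤ) : S) := by
  obtain ⟨R, hR⟩ := prod_pairs_expansion (fun i : Fin n => (MvPolynomial.X i : MvPolynomial (Fin n) ℤ))
  simp only [coeff_prod_one_add_X_eq_esymm] at hR
  have hsymm : R.IsSymmetric := by
    intro e
    have h := congrArg (MvPolynomial.rename e) hR
    have h64 : (64 : MvPolynomial (Fin n) ℤ) ≠ 0 := by norm_num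
    refine mul_left_cancel₀ h64 ?_
    simp only [map_add, map_mul, map_sub, map_prod, map_one, map_ofNat, MvPolynomial.rename_X,
      MvPolynomial.rename_esymm] at h
    rw [prod_pairs_comp_perm e (fun i j : Fin n =>
      (1 + 4 * (MvPolynomial.X i * MvPolynomial.X j) : MvPolynomial (Fin n) ℤ))
      (fun i j => by rw [mul_comm (MvPolynomial.X i)]), hR] at h
    exact (add_left_cancel h).symm
  obtain ⟨z, hz⟩ := exists_int_of_isSymmetric x V hV R hsymm
  refine ⟨z, ?_⟩
  have h := congrArg (MvPolynomial.aeval x) hR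
  simp only [map_add, map_mul, map_sub, map_prod, map_one, map_ofNat, MvPolynomial.aeval_X,
    aeval_esymm_eq_coeff, hV, coeff_map, hz] at h
  rw [h]
  push_cast
  simp

/-! ### The numbers `2 cos (2πj/(2n+1))` and products over residues -/

/-- The real number `2 cos (2 π j / (2 n + 1))`. -/
noncomputable def chord (n : ℕ) (j : ZMod (2 * n + 1)) : ℝ :=
  2 * Real.cos (2 * Real.pi * j.val / (2 * n + 1))

theorem chord_intCast (n : ℕ) (m : ℤ) :
    chord n (m : ZMod (2 * n + 1)) = 2 * Real.cos (2 * Real.pi * m / (2 * n + 1)) := by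
  have h : (((m : ZMod (2 * n + 1)).val : ℕ) : ℤ) = m - (2 * n + 1) * (m / (2 * n + 1)) := by
    rw [ZMod.val_intCast, Int.emod_def]; push_cast; rfl
  have h' : (((m : ZMod (2 * n + 1)).val : ℕ) : ℝ) =
      m - (2 * n + 1) * ((m / (2 * n + 1) : ℤ) : ℝ) := by exact_mod_cast h
  have hN : (2 * n + 1 : ℝ) ≠ 0 := by positivity
  rw [chord, h', ← Real.cos_sub_int_mul_two_pi (2 * Real.pi * m / (2 * n + 1)) (m / (2 * n + 1) : ℤ)]
  congr 2
  field_simp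

theorem chord_natCast (n m : ℕ) :
    chord n (m : ZMod (2 * n + 1)) = 2 * Real.cos (2 * Real.pi * m / (2 * n + 1)) := by
  simpa using chord_intCast n m

theorem chord_neg (n : ℕ) (j : ZMod (2 * n + 1)) : chord n (-j) = chord n j := by
  obtain ⟨m, rfl⟩ := ZMod.intCast_surjective j
  rw [← Int.cast_neg, chord_intCast, chord_intCast, ← Real.cos_neg]
  push_cast
  congr 2
  ring

theorem chord_mul_chord (n : ℕ) (j k : ZMod (2 * n + 1)) :
    chord n j * chord n k = chord n (j + k) + chord n (j - k) := by
  obtain ⟨a, rfl⟩ := ZMod.intCast_surjective j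
  obtain ⟨b, rfl⟩ := ZMod.intCast_surjective k
  rw [← Int.cast_add, ← Int.cast_sub, chord_intCast, chord_intCast, chord_intCast, chord_intCast]
  push_cast
  rw [mul_add, mul_sub, add_div, sub_div, Real.cos_add, Real.cos_sub]
  ring

/-- The residues `n+1, …, 2n` are the negatives of `n, …, 1`. -/
theorem prod_fin_two_mul_of_even {M : Type*} [CommMonoid M] {n : ℕ} (f : ZMod (2 * n + 1) → M)
    (hf : ∀ j, f (-j) = f j) :
    ∏ i : Fin (2 * n), f (i + 1 : ℕ) = (∏ i : Fin n, f (i + 1 : ℕ)) ^ 2 := by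
  have h := Finset.prod_range_add (fun i => f (i + 1 : ℕ)) n n
  rw [← two_mul] at h
  rw [← Finset.prod_range (fun i => f (i + 1 : ℕ)), h,
    ← Finset.prod_range (fun i => f (i + 1 : ℕ)), sq]
  congr 1
  rw [← Finset.prod_range_reflect]
  refine Finset.prod_congr rfl fun i hi => ?_
  rw [← hf]
  congr 1
  have hi : i < n := Finset.mem_range.1 hi
  rw [neg_eq_iff_add_eq_zero, ← Nat.cast_add, show n + (n - 1 - i) + 1 + (i + 1) = 2 * n + 1 by omega]
  exact ZMod.natCast_self _

theorem prod_zmod_of_even {M : Type*} [CommMonoid M] {n : ℕ} (f : ZMod (2 * n + 1) → M)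
    (hf : ∀ j, f (-j) = f j) :
    ∏ j, f j = f 0 * (∏ i : Fin n, f (i + 1 : ℕ)) ^ 2 := by
  rw [← prod_fin_two_mul_of_even f hf]
  have h : ∏ j, f j = ∏ j : Fin (2 * n + 1), f (j : ℕ) := by
    refine Finset.prod_congr rfl fun j _ => ?_
    congr 1
    exact (ZMod.natCast_zmod_val (n := 2 * n + 1) j).symm
  rw [h, Fin.prod_univ_succ]
  simp

theorem prod_fin_prod_of_symm {M : Type*} [CommMonoid M] {n : ℕ} (g : Fin n → Fin n → M)
    (hg : ∀ i j, g i j = g j i) :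
    ∏ i, ∏ j, g i j = (∏ i, g i i) * (∏ i, ∏ j ∈ Finset.Ioi i, g i j) ^ 2 := by
  have h := Finset.prod_prod_Ioi_mul_eq_prod_prod_off_diag g
  have h1 : ∏ i, ∏ j ∈ Finset.Ioi i, (g j i * g i j) = (∏ i, ∏ j ∈ Finset.Ioi i, g i j) ^ 2 := by
    rw [← Finset.prod_pow]
    refine Finset.prod_congr rfl fun i _ => ?_
    rw [← Finset.prod_pow]
    exact Finset.prod_congr rfl fun j _ => by rw [hg j i, sq]
  rw [← h1, h, ← Finset.prod_mul_distrib]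
  refine Finset.prod_congr rfl fun i _ => ?_
  rw [← Finset.prod_mul_prod_compl {i}, Finset.prod_singleton]
  congr 1
  exact Finset.prod_congr rfl fun j _ => hg i j

theorem natCast_succ_ne_zero {n : ℕ} (i : Fin n) : ((i + 1 : ℕ) : ZMod (2 * n + 1)) ≠ 0 := by
  rw [Ne, ZMod.natCast_eq_zero_iff]
  intro h
  have := Nat.le_of_dvd (Nat.succ_pos _) h
  omega

theorem natCast_succ_eq_iff {n : ℕ} (i j : Fin n) :
    ((i + 1 : ℕ) : ZMod (2 * n + 1)) = ((j + 1 : ℕ) : ZMod (2 * n + 1)) ↔ i = j := by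
  rw [ZMod.natCast_eq_natCast_iff', Nat.mod_eq_of_lt (by omega), Nat.mod_eq_of_lt (by omega)]
  omega

theorem natCast_succ_ne_neg {n : ℕ} (i j : Fin n) :
    ((i + 1 : ℕ) : ZMod (2 * n + 1)) ≠ -((j + 1 : ℕ) : ZMod (2 * n + 1)) := by
  rw [Ne, eq_neg_iff_add_eq_zero, ← Nat.cast_add, ZMod.natCast_eq_zero_iff]
  intro h
  have := Nat.le_of_dvd (by omega) h
  omega

open Classical in
/-- The product over the pairs `(j, k)` of nonzero residues with `j ≠ ± k`. -/
theorem prod_zmod_pairs {M : Type*} [CommMonoid M] {n : ℕ}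
    (g : ZMod (2 * n + 1) → ZMod (2 * n + 1) → M) (hg : ∀ j k, g j k = g k j)
    (hneg : ∀ j k, g (-j) k = g j k) :
    ∏ j, ∏ k, (if j = 0 ∨ k = 0 ∨ j = k ∨ j = -k then 1 else g j k) =
      (∏ a : Fin n, ∏ b ∈ Finset.Ioi a, g (a + 1 : ℕ) (b + 1 : ℕ)) ^ 8 := by
  have hneg' : ∀ j k, g j (-k) = g j k := fun j k => by rw [hg, hneg, hg]
  rw [prod_zmod_of_even]
  · simp only [true_or, if_true, Finset.prod_const_one, one_mul]
    have h1 : ∀ a : Fin n, ∏ k, (if ((a + 1 : ℕ) : ZMod (2 * n + 1)) = 0 ∨ k = 0 ∨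
        ((a + 1 : ℕ) : ZMod (2 * n + 1)) = k ∨ ((a + 1 : ℕ) : ZMod (2 * n + 1)) = -k then 1 else g (a + 1 : ℕ) k) =
        (∏ b : Fin n, if a = b then 1 else g (a + 1 : ℕ) (b + 1 : ℕ)) ^ 2 := by
      intro a
      rw [prod_zmod_of_even]
      · simp only [true_or, or_true, if_true, one_mul]
        congr 1
        refine Finset.prod_congr rfl fun b _ => ?_
        simp only [natCast_succ_ne_zero, natCast_succ_eq_iff, natCast_succ_ne_neg, false_or, or_false]
      · intro k
        rw [hneg']
        congr 1
        simp only [neg_eq_zero, neg_neg, eq_iff_iff]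
        tauto
    -- The exponent 8 counts two signs for each entry and two orders of the pair.
    rw [Finset.prod_congr rfl fun a _ => h1 a, Finset.prod_pow, prod_fin_prod_of_symm]
    · simp only [if_true, Finset.prod_const_one, one_mul, ← pow_mul]
      congr 1
      refine Finset.prod_congr rfl fun a _ => Finset.prod_congr rfl fun b hb => ?_
      rw [if_neg (Finset.mem_Ioi.1 hb).ne]
    · intro a b
      rw [hg]
      simp only [eq_comm]
  · intro j
    refine Finset.prod_congr rfl fun k _ => ?_
    rw [hneg]
    congr 1
    simp only [neg_eq_iff_eq_neg, neg_zero, neg_neg, eq_iff_iff]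
    tauto

/-- The change of variables `(j, k) ↦ (j + k, j - k)`. -/
theorem prod_pairs_chord_add (n : ℕ) :
    (∏ a : Fin n, ∏ b ∈ Finset.Ioi a, (4 + chord n (a + 1 : ℕ) + chord n (b + 1 : ℕ))) ^ 8 =
      (∏ a : Fin n, ∏ b ∈ Finset.Ioi a, (4 + chord n (a + 1 : ℕ) * chord n (b + 1 : ℕ))) ^ 8 := by
  classical
  rw [← prod_zmod_pairs (fun j k => 4 + chord n j + chord n k) (fun j k => by ring)
    (fun j k => by rw [chord_neg]),
    ← prod_zmod_pairs (fun j k => 4 + chord n j * chord n k) (fun j k => by ring)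
    (fun j k => by rw [chord_neg]), ← Fintype.prod_prod_type', ← Fintype.prod_prod_type']
  -- Since `2n+1` is odd, 2 is invertible, which makes `(j, k) ↦ (j + k, j - k)` a bijection.
  have hu : IsUnit (2 : ZMod (2 * n + 1)) := by
    have : IsUnit ((2 : ℕ) : ZMod (2 * n + 1)) := by
      rw [ZMod.isUnit_iff_coprime]
      simp
    simpa using this
  have h2 : ∀ x : ZMod (2 * n + 1), x + x = 0 ↔ x = 0 := fun x => by
    rw [← two_mul, hu.mul_right_eq_zero]
  symm
  refine Fintype.prod_bijective (fun p : ZMod (2 * n + 1) × ZMod (2 * n + 1) => (p.1 + p.2, p.1 - p.2))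
    (Finite.injective_iff_bijective.1 ?_) _ _ ?_
  · rintro ⟨a, b⟩ ⟨c, d⟩ h
    simp only [Prod.mk.injEq] at h
    obtain ⟨h3, h4⟩ := h
    have h5 : a - c = 0 := (h2 _).1 (by linear_combination h3 + h4)
    have h6 : a = c := sub_eq_zero.1 h5
    subst h6
    simpa using h3
  · rintro ⟨j, k⟩
    -- The substitution permutes the four excluded conditions `j = 0`, `k = 0`, `j = k`, `j = -k`.
    have e1 : j + k = 0 ↔ j = -k := eq_neg_iff_add_eq_zero.symm
    have e2 : j - k = 0 ↔ j = k := sub_eq_zero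
    have e3 : j + k = j - k ↔ k = 0 := by
      rw [← h2 k, ← sub_eq_zero]; ring_nf
    have e4 : j + k = -(j - k) ↔ j = 0 := by
      rw [← h2 j, ← sub_eq_zero]; ring_nf
    simp only [e1, e2, e3, e4, chord_mul_chord, add_assoc]
    congr 1
    simp only [eq_iff_iff]
    tauto

/-! ### The integer polynomial with these roots and its low coefficients -/

open Polynomial in
/-- The monic integer polynomial of degree `n` with roots `2 cos (2 π j / (2 n + 1))`,
`1 ≤ j ≤ n`. -/
noncomputable def chordPoly : ℕ → ℤ[X]
  | 0 => 1
  | 1 => X + 1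
  | n + 2 => X * chordPoly (n + 1) - chordPoly n

open Polynomial in
theorem eval_chordPoly_mul_sin (n : ℕ) (θ : ℝ) :
    ((chordPoly n).map (Int.castRingHom ℝ)).eval (2 * Real.cos θ) * Real.sin θ =
      Real.sin ((n + 1) * θ) + Real.sin (n * θ) := by
  induction n using Nat.twoStepInduction with
  | zero => simp [chordPoly]
  | one =>
    have : ((1 : ℕ) + 1 : ℝ) * θ = 2 * θ := by norm_num
    rw [this, Real.sin_two_mul]
    simp [chordPoly]
    ring
  | more n h1 h2 =>
    rw [chordPoly, Polynomial.map_sub, Polynomial.map_mul, map_X, eval_sub, eval_mul, eval_X, sub_mul,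
      mul_assoc, h1, h2]
    have e1 : (((n + 2 : ℕ) : ℝ) + 1) * θ = (n + 1) * θ + θ + θ := by push_cast; ring
    have e2 : ((n + 2 : ℕ) : ℝ) * θ = n * θ + θ + θ := by push_cast; ring
    have e3 : (((n + 1 : ℕ) : ℝ) + 1) * θ = (n + 1) * θ + θ := by push_cast; ring
    have e4 : ((n + 1 : ℕ) : ℝ) * θ = n * θ + θ := by push_cast; ring
    have key : ∀ x : ℝ, Real.sin (x + θ + θ) = 2 * Real.cos θ * Real.sin (x + θ) - Real.sin x := by
      intro x
      rw [Real.sin_add (x + θ), Real.sin_add x, Real.cos_add x]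
      linear_combination (-Real.sin x) * Real.sin_sq_add_cos_sq θ
    rw [e1, e2, e3, e4, key, key]
    ring

open Polynomial in
theorem chordPoly_monic_natDegree (n : ℕ) : (chordPoly n).Monic ∧ (chordPoly n).natDegree = n := by
  induction n using Nat.twoStepInduction with
  | zero => simp [chordPoly]
  | one => exact ⟨by simpa [chordPoly] using monic_X_add_C (1 : ℤ), by simpa [chordPoly] using natDegree_X_add_C (1 : ℤ)⟩
  | more n h1 h2 =>
    have hm : (X * chordPoly (n + 1)).Monic := monic_X.mul h2.1
    have hd : (X * chordPoly (n + 1)).natDegree = n + 2 := by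
      rw [monic_X.natDegree_mul h2.1, natDegree_X, h2.2]; ring
    have hlt : (chordPoly n).degree < (X * chordPoly (n + 1)).degree := by
      apply degree_lt_degree
      omega
    rw [chordPoly]
    exact ⟨hm.sub_of_left hlt, by rw [natDegree_sub_eq_left_of_natDegree_lt (by omega), hd]⟩

theorem chord_succ_injective (n : ℕ) :
    Function.Injective fun i : Fin n => chord n (i + 1 : ℕ) := by
  intro i j h
  simp only [chord_natCast] at h
  have hN : (0 : ℝ) < 2 * n + 1 := by positivity
  have hmem : ∀ i : Fin n, 2 * Real.pi * ((i + 1 : ℕ) : ℝ) / (2 * n + 1) ∈ Set.Icc 0 Real.pi := by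
    intro i
    refine ⟨by positivity, ?_⟩
    rw [div_le_iff₀ hN]
    have : ((i + 1 : ℕ) : ℝ) ≤ n := by exact_mod_cast i.2
    nlinarith [Real.pi_pos]
  have h2 := Real.injOn_cos (hmem i) (hmem j) (by linarith)
  have hpi := Real.pi_ne_zero
  field_simp at h2
  have h3 : (i : ℕ) + 1 = j + 1 := by exact_mod_cast h2
  exact Fin.ext (by omega)

-- Both sides are monic of degree `n` and agree at the `n` distinct chords.
open Polynomial in
theorem prod_X_sub_chord (n : ℕ) :
    ∏ i : Fin n, (X - C (chord n (i + 1 : ℕ))) = (chordPoly n).map (Int.castRingHom ℝ) := by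
  obtain ⟨hm, hd⟩ := chordPoly_monic_natDegree n
  have hm' : ((chordPoly n).map (Int.castRingHom ℝ)).Monic := hm.map _
  have hd' : ((chordPoly n).map (Int.castRingHom ℝ)).degree = n := by
    rw [hm.degree_map, degree_eq_natDegree hm.ne_zero, hd]
  have hp : (∏ i : Fin n, (X - C (chord n (i + 1 : ℕ)))).Monic := monic_prod_X_sub_C _ _
  have hpd : (∏ i : Fin n, (X - C (chord n (i + 1 : ℕ)))).degree = (n : WithBot ℕ) := by
    rw [degree_prod]; simp
  refine Polynomial.eq_of_degree_sub_lt_of_eval_index_eq (s := Finset.univ)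
    (v := fun i : Fin n => chord n (i + 1 : ℕ)) (chord_succ_injective n).injOn ?_ ?_
  · rw [Finset.card_univ, Fintype.card_fin, ← hpd]
    exact degree_sub_lt_left (by rw [hpd, hd']) hp.ne_zero (by rw [hp.leadingCoeff, hm'.leadingCoeff])
  · intro i _
    rw [eval_prod, Finset.prod_eq_zero (Finset.mem_univ i) (by simp)]
    symm
    have hN : (0 : ℝ) < 2 * n + 1 := by positivity
    have hpi := Real.pi_pos
    set θ : ℝ := 2 * Real.pi * ((i + 1 : ℕ) : ℝ) / (2 * n + 1) with hθ
    have hsin : 0 < Real.sin θ := by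
      refine Real.sin_pos_of_pos_of_lt_pi (by positivity) ?_
      rw [hθ, div_lt_iff₀ hN]
      have : ((i + 1 : ℕ) : ℝ) ≤ n := by exact_mod_cast i.2
      nlinarith
    have h := eval_chordPoly_mul_sin n θ
    rw [← chord_natCast] at h
    have h0 : Real.sin ((n + 1) * θ) + Real.sin (n * θ) = 0 := by
      -- As `(2n+1)θ` is a multiple of `2π`, the two sines cancel.
      have e : (n + 1) * θ = ((i + 1 : ℕ) : ℝ) * (2 * Real.pi) - n * θ := by
        rw [hθ]; field_simp; ring
      rw [e, Real.sin_nat_mul_two_pi_sub]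
      ring
    rw [h0] at h
    exact (mul_eq_zero.1 h).resolve_right hsin.ne'

open Polynomial in
theorem chordPoly_coeff_succ (n k : ℕ) :
    (chordPoly (n + 2)).coeff (k + 1) = (chordPoly (n + 1)).coeff k - (chordPoly n).coeff (k + 1) := by
  rw [chordPoly, coeff_sub, coeff_X_mul]

open Polynomial in
theorem chordPoly_coeff_zero (n : ℕ) :
    (chordPoly (n + 2)).coeff 0 = - (chordPoly n).coeff 0 := by
  rw [chordPoly, coeff_sub, coeff_X_mul_zero, zero_sub]

-- The signs depend on `n` modulo 4, so the induction advances two indices at a time; each step is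
-- the recurrence together with Pascal's rule.
open Polynomial in
theorem chordPoly_coeffs (m : ℕ) :
    ((chordPoly (2 * m)).coeff 0 = (-1) ^ m ∧
      (chordPoly (2 * m)).coeff 1 = -(-1) ^ m * m ∧
      (chordPoly (2 * m)).coeff 2 = -(-1) ^ m * (m + 1).choose 2 ∧
      (chordPoly (2 * m)).coeff 3 = (-1) ^ m * (m + 1).choose 3 ∧
      (chordPoly (2 * m)).coeff 4 = (-1) ^ m * (m + 2).choose 4) ∧
    ((chordPoly (2 * m + 1)).coeff 0 = (-1) ^ m ∧
      (chordPoly (2 * m + 1)).coeff 1 = (-1) ^ m * (m + 1) ∧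
      (chordPoly (2 * m + 1)).coeff 2 = -(-1) ^ m * (m + 1).choose 2 ∧
      (chordPoly (2 * m + 1)).coeff 3 = -(-1) ^ m * (m + 2).choose 3 ∧
      (chordPoly (2 * m + 1)).coeff 4 = (-1) ^ m * (m + 2).choose 4) := by
  induction m with
  | zero => simp [chordPoly, coeff_one, coeff_X, Nat.choose]
  | succ m ih =>
    obtain ⟨⟨a0, a1, a2, a3, a4⟩, b0, b1, b2, b3, b4⟩ := ih
    have c0 := chordPoly_coeff_zero (2 * m)
    have c1 := chordPoly_coeff_succ (2 * m) 0
    have c2 := chordPoly_coeff_succ (2 * m) 1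
    have c3 := chordPoly_coeff_succ (2 * m) 2
    have c4 := chordPoly_coeff_succ (2 * m) 3
    have d0 := chordPoly_coeff_zero (2 * m + 1)
    have d1 := chordPoly_coeff_succ (2 * m + 1) 0
    have d2 := chordPoly_coeff_succ (2 * m + 1) 1
    have d3 := chordPoly_coeff_succ (2 * m + 1) 2
    have d4 := chordPoly_coeff_succ (2 * m + 1) 3
    have e : ∀ k, ((m + 2).choose (k + 1) : ℤ) = (m + 1).choose k + (m + 1).choose (k + 1) := fun k => by
      rw [Nat.choose_succ_succ]; push_cast; rfl
    have f : ∀ k, ((m + 3).choose (k + 1) : ℤ) = (m + 2).choose k + (m + 2).choose (k + 1) := fun k => by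
      rw [Nat.choose_succ_succ]; push_cast; rfl
    have e1 : ((m + 1).choose 1 : ℤ) = m + 1 := by simp
    have f1 : ((m + 2).choose 1 : ℤ) = m + 2 := by simp
    have e2 := e 1
    have e3 := e 2
    have f2 := f 1
    have f3 := f 2
    have f4 := f 3
    simp only [show 2 * m + 1 + 1 = 2 * m + 2 from rfl, Nat.reduceAdd, zero_add, add_assoc] at *
    rw [show 2 * (m + 1) = 2 * m + 2 by ring, show 2 * m + 2 + 1 = 2 * m + 3 by ring]
    simp only [show m + 1 + 1 = m + 2 from rfl, show m + 1 + 2 = m + 3 from rfl, pow_succ]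
    rw [d0, d1, d2, d3, d4, c0, c1, c2, c3, c4, a0, a1, a2, a3, a4, b0, b1, b2, b3, b4]
    push_cast
    rw [f4, f3, e3, e2, e1]
    generalize (-1 : ℤ) ^ m = u
    refine ⟨⟨?_, ?_, ?_, ?_, ?_⟩, ?_, ?_, ?_, ?_, ?_⟩ <;> ring

/-- Each `y a` lies in `n - 1` pairs; the extra factor avoids the subtraction. -/
theorem prod_pairs_mul_prod {M : Type*} [CommMonoid M] {n : ℕ} (y : Fin n → M) :
    (∏ a, ∏ b ∈ Finset.Ioi a, y a * y b) * ∏ a, y a = (∏ a, y a) ^ n := by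
  induction n with
  | zero => simp
  | succ n ih =>
    have h := ih (fun i => y i.succ)
    rw [Fin.prod_univ_succ, Fin.prod_Ioi_zero, Fin.prod_univ_succ y, Finset.prod_mul_distrib,
      Finset.prod_const, Finset.card_univ, Fintype.card_fin, mul_pow, pow_succ, pow_succ _ n, ← h]
    simp only [Fin.prod_Ioi_succ]
    ac_rfl

theorem chordPoly_coeff_zero_sq (n : ℕ) : (chordPoly n).coeff 0 ^ 2 = 1 := by
  obtain ⟨m, rfl | rfl⟩ := n.even_or_odd'
  · rw [(chordPoly_coeffs m).1.1, ← pow_mul, mul_comm, pow_mul]; simp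
  · rw [(chordPoly_coeffs m).2.1, ← pow_mul, mul_comm, pow_mul]; simp

open Polynomial in
theorem prod_neg_chord (n : ℕ) :
    ∏ i : Fin n, -chord n (i + 1 : ℕ) = ((chordPoly n).coeff 0 : ℝ) := by
  have h := congrArg (fun p => p.eval 0) (prod_X_sub_chord n)
  simp only [eval_prod, eval_sub, eval_X, eval_C, zero_sub] at h
  rw [h, ← coeff_zero_eq_eval_zero, coeff_map, eq_intCast]

theorem chord_succ_ne_zero {n : ℕ} (i : Fin n) : chord n (i + 1 : ℕ) ≠ 0 := by
  intro h
  have h1 := prod_neg_chord n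
  rw [Finset.prod_eq_zero (Finset.mem_univ i) (by rw [h, neg_zero])] at h1
  have h2 : (chordPoly n).coeff 0 = 0 := by exact_mod_cast h1.symm
  have h3 := chordPoly_coeff_zero_sq n
  simp [h2] at h3

-- Dividing `∏ (X - c_i)` by its constant term gives the left side. That constant is `±1`, so
-- dividing by it is multiplying by it.
open Polynomial in
theorem prod_one_sub_inv_chord (n : ℕ) :
    ∏ i : Fin n, (1 + C (-(chord n (i + 1 : ℕ))⁻¹) * X) =
      (C ((chordPoly n).coeff 0) * chordPoly n).map (Int.castRingHom ℝ) := by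
  have h : ∏ i : Fin n, (X - C (chord n (i + 1 : ℕ))) =
      C (∏ i : Fin n, -chord n (i + 1 : ℕ)) *
        ∏ i : Fin n, (1 + C (-(chord n (i + 1 : ℕ))⁻¹) * X) := by
    rw [map_prod, ← Finset.prod_mul_distrib]
    refine Finset.prod_congr rfl fun i _ => ?_
    rw [mul_add, ← mul_assoc, ← C_mul, neg_mul_neg, mul_inv_cancel₀ (chord_succ_ne_zero i)]
    simp
    ring
  rw [Polynomial.map_mul, ← prod_X_sub_chord, h, ← mul_assoc, prod_neg_chord, map_C, ← C_mul, eq_intCast,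
    ← Int.cast_mul, ← sq, chordPoly_coeff_zero_sq]
  simp

/-! ### The product `B` as an integer modulo 64, and its role in the double product -/

/-- The square root of the odd part of the number of tilings, as a real number. -/
noncomputable def chordProduct (n : ℕ) : ℝ :=
  ∏ a : Fin n, ∏ b ∈ Finset.Ioi a, (4 + chord n (a + 1 : ℕ) * chord n (b + 1 : ℕ))

theorem abs_chord_succ_lt {n : ℕ} (i : Fin n) : |chord n (i + 1 : ℕ)| < 2 := by
  have h0 : (0 : ℝ) < 2 * n + 1 := by positivity
  have hpi := Real.pi_pos
  have hi : ((i + 1 : ℕ) : ℝ) ≤ n := by exact_mod_cast i.2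
  have hi0 : (0 : ℝ) < ((i + 1 : ℕ) : ℝ) := by positivity
  rw [chord_natCast]
  set θ : ℝ := 2 * Real.pi * ((i + 1 : ℕ) : ℝ) / (2 * n + 1) with hθ
  have h1 : 0 < θ := by positivity
  have h2 : θ < Real.pi := by
    rw [hθ, div_lt_iff₀ h0]; nlinarith
  have h3 : Real.cos θ < 1 := by
    rw [← Real.cos_zero]; exact Real.cos_lt_cos_of_nonneg_of_le_pi le_rfl h2.le h1
  have h4 : -1 < Real.cos θ := by
    rw [← Real.cos_pi]; exact Real.cos_lt_cos_of_nonneg_of_le_pi h1.le le_rfl h2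
  rw [abs_lt]
  constructor <;> linarith

theorem chordProduct_pos (n : ℕ) : 0 < chordProduct n := by
  refine Finset.prod_pos fun a _ => Finset.prod_pos fun b _ => ?_
  have ha := abs_chord_succ_lt a
  have hb := abs_chord_succ_lt b
  have : |chord n (a + 1 : ℕ) * chord n (b + 1 : ℕ)| < 4 := by
    rw [abs_mul]
    nlinarith [abs_nonneg (chord n (a + 1 : ℕ)), abs_nonneg (chord n (b + 1 : ℕ))]
  linarith [(abs_lt.1 this).1]

/-- The eighth powers agree, and both products are nonnegative because each chord exceeds `-2`. -/
theorem prod_pairs_add_chord (n : ℕ) :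
    ∏ a : Fin n, ∏ b ∈ Finset.Ioi a, (4 + chord n (a + 1 : ℕ) + chord n (b + 1 : ℕ)) =
      chordProduct n := by
  refine (pow_left_inj₀ ?_ (chordProduct_pos n).le (by norm_num : (8 : ℕ) ≠ 0)).1 (prod_pairs_chord_add n)
  refine Finset.prod_nonneg fun a _ => Finset.prod_nonneg fun b _ => ?_
  linarith [(abs_lt.1 (abs_chord_succ_lt a)).1, (abs_lt.1 (abs_chord_succ_lt b)).1]

theorem chordProduct_eq (n : ℕ) :
    ∃ z : ℤ, chordProduct n = (((chordPoly n).coeff 0) ^ (n + 1) *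
      (1 + 4 * ((chordPoly n).coeff 0 * (chordPoly n).coeff 2) +
        16 * ((chordPoly n).coeff 0 * (chordPoly n).coeff 1 *
          ((chordPoly n).coeff 0 * (chordPoly n).coeff 3) -
          (chordPoly n).coeff 0 * (chordPoly n).coeff 4) + 64 * z) : ℤ) := by
  obtain ⟨z, hz⟩ := prod_pairs_eq_int _ _ (prod_one_sub_inv_chord n)
  simp only [Polynomial.coeff_C_mul] at hz
  refine ⟨z, ?_⟩
  rw [Int.cast_mul, ← hz, Int.cast_pow, ← prod_neg_chord]
  have hsq : (∏ i : Fin n, -chord n (i + 1 : ℕ)) ^ 2 = 1 := by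
    rw [prod_neg_chord]; exact_mod_cast chordPoly_coeff_zero_sq n
  have h1 := prod_pairs_mul_prod (fun i : Fin n => -chord n (i + 1 : ℕ))
  -- The exponent should be `n - 1`; it may be raised by 2 because the product squares to 1.
  have h2 : (∏ i : Fin n, -chord n (i + 1 : ℕ)) ^ (n + 1) =
      ∏ a : Fin n, ∏ b ∈ Finset.Ioi a, -chord n (a + 1 : ℕ) * -chord n (b + 1 : ℕ) := by
    rw [pow_succ, ← h1, mul_assoc, ← sq, hsq, mul_one]
  rw [h2, chordProduct, ← Finset.prod_mul_distrib]
  refine Finset.prod_congr rfl fun a _ => ?_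
  rw [← Finset.prod_mul_distrib]
  refine Finset.prod_congr rfl fun b _ => ?_
  have ha := chord_succ_ne_zero a
  have hb := chord_succ_ne_zero b
  field_simp
  ring

-- Up to the sign `(-1)^n`, this is the value of `chordPoly n` at `-2`.
open Polynomial in
theorem prod_two_add_chord (n : ℕ) : ∏ i : Fin n, (2 + chord n (i + 1 : ℕ)) = 1 := by
  have hW : ∀ n, (chordPoly n).eval (-2) = (-1) ^ n := by
    intro n
    induction n using Nat.twoStepInduction with
    | zero => simp [chordPoly]
    | one => simp [chordPoly]
    | more n h1 h2 =>
      rw [chordPoly, eval_sub, eval_mul, eval_X, h1, h2]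
      ring
  have h := congrArg (fun p => p.eval (((-2 : ℤ) : ℝ))) (prod_X_sub_chord n)
  simp only [eval_prod, eval_sub, eval_X, eval_C, eval_intCast_map, Int.cast_id, hW] at h
  have h2 : ∏ i : Fin n, (2 + chord n (i + 1 : ℕ)) =
      (-1) ^ n * ∏ i : Fin n, (((-2 : ℤ) : ℝ) - chord n (i + 1 : ℕ)) := by
    have : ((-1 : ℝ)) ^ n = ∏ _i : Fin n, (-1 : ℝ) := by simp
    rw [this, ← Finset.prod_mul_distrib]
    exact Finset.prod_congr rfl fun i _ => by push_cast; ring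
  rw [h2, h]
  simp [← mul_pow]

theorem prod_prod_four_add_chord (n : ℕ) :
    ∏ k : Fin (2 * n), ∏ l : Fin (2 * n), (4 + chord n (k + 1 : ℕ) + chord n (l + 1 : ℕ)) =
      (2 ^ n * chordProduct n ^ 2) ^ 4 := by
  have h1 : ∀ j : ZMod (2 * n + 1), ∏ l : Fin (2 * n), (4 + chord n j + chord n (l + 1 : ℕ)) =
      (∏ l : Fin n, (4 + chord n j + chord n (l + 1 : ℕ))) ^ 2 := fun j =>
    prod_fin_two_mul_of_even (fun l => 4 + chord n j + chord n l) (fun l => by rw [chord_neg])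
  simp only [h1]
  rw [Finset.prod_pow, prod_fin_two_mul_of_even
    (fun j => ∏ l : Fin n, (4 + chord n j + chord n (l + 1 : ℕ))) (fun j => by simp only [chord_neg]),
    prod_fin_prod_of_symm _ (fun i j => by ring), prod_pairs_add_chord, ← pow_mul]
  have h2 : ∏ i : Fin n, (4 + chord n (i + 1 : ℕ) + chord n (i + 1 : ℕ)) = 2 ^ n := by
    have : ∀ i : Fin n, 4 + chord n (i + 1 : ℕ) + chord n (i + 1 : ℕ) =
        2 * (2 + chord n (i + 1 : ℕ)) := fun i => by ring
    simp only [this, Finset.prod_mul_distrib, prod_two_add_chord]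
    simp
  rw [h2]

open Polynomial in
theorem chordProduct_three : chordProduct 3 = 29 := by
  have h : ∀ t : ℝ, (t - chord 3 (0 + 1 : ℕ)) * (t - chord 3 (1 + 1 : ℕ)) *
      (t - chord 3 (2 + 1 : ℕ)) = t * (t * (t + 1) - 1) - (t + 1) := fun t => by
    have := congrArg (fun p => p.eval t) (prod_X_sub_chord 3)
    rw [Fin.prod_univ_three] at this
    simp only [eval_mul, eval_sub, eval_X, eval_C, chordPoly, Polynomial.map_sub,
      Polynomial.map_mul, Polynomial.map_add, Polynomial.map_one, map_X, eval_add, eval_one] at this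
    exact this
  have e0 : Finset.Ioi (0 : Fin 3) = {1, 2} := by decide
  have e1 : Finset.Ioi (1 : Fin 3) = {2} := by decide
  have e2 : Finset.Ioi (2 : Fin 3) = ∅ := by decide
  have hB : chordProduct 3 = (4 + chord 3 (0 + 1 : ℕ) * chord 3 (1 + 1 : ℕ)) *
      (4 + chord 3 (0 + 1 : ℕ) * chord 3 (2 + 1 : ℕ)) *
      (4 + chord 3 (1 + 1 : ℕ) * chord 3 (2 + 1 : ℕ)) := by
    rw [chordProduct, Fin.prod_univ_three, e0, e1, e2, Finset.prod_pair (by decide),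
      Finset.prod_singleton, Finset.prod_empty, mul_one]
    rfl
  rw [hB]
  generalize chord 3 (0 + 1 : ℕ) = a at *
  generalize chord 3 (1 + 1 : ℕ) = b at *
  generalize chord 3 (2 + 1 : ℕ) = c at *
  -- The values of the cubic at `0, 1, -1` determine the symmetric functions of its roots.
  have h3 : a * b * c = 1 := by linear_combination -h 0
  have h2 : a * b + a * c + b * c = -2 := by linear_combination (h 1 - h (-1)) / 2
  have h1 : a + b + c = -1 := by linear_combination h 0 - (h 1 + h (-1)) / 2
  linear_combination 16 * h2 + 4 * (a + b + c) * h3 + 4 * h1 + (a * b * c + 1) * h3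

/-! ### The binomial congruences modulo 32 -/

theorem choose_two_add_sixteen (m : ℕ) : (m + 16).choose 2 % 8 = m.choose 2 % 8 := by
  have h : ∀ k, (k + 1).choose 2 = k + k.choose 2 := fun k => by simp [Nat.choose_succ_succ' k 1]
  simp only [h]
  omega

theorem choose_three_add_sixteen (m : ℕ) : (m + 16).choose 3 % 2 = m.choose 3 % 2 := by
  have h : ∀ k, (k + 1).choose 2 = k + k.choose 2 := fun k => by simp [Nat.choose_succ_succ' k 1]
  have h3 : ∀ k, (k + 1).choose 3 = k.choose 2 + k.choose 3 := fun k => Nat.choose_succ_succ' k 2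
  simp only [h, h3]
  omega

theorem choose_four_add_sixteen (m : ℕ) : (m + 16).choose 4 % 2 = m.choose 4 % 2 := by
  have h : ∀ k, (k + 1).choose 2 = k + k.choose 2 := fun k => by simp [Nat.choose_succ_succ' k 1]
  have h3 : ∀ k, (k + 1).choose 3 = k.choose 2 + k.choose 3 := fun k => Nat.choose_succ_succ' k 2
  have h4 : ∀ k, (k + 1).choose 4 = k.choose 3 + k.choose 4 := fun k => Nat.choose_succ_succ' k 3
  simp only [h, h3, h4]
  omega

theorem exists_eq_add_mul_of_mod_eq {a b d : ℕ} (h : a % d = b % d) :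
    ∃ t : ℤ, (a : ℤ) = b + d * t := by
  have h' : (a : ℤ) % d = (b : ℤ) % d := by exact_mod_cast h
  obtain ⟨t, ht⟩ := Int.modEq_iff_dvd.1 h'.symm
  exact ⟨t, by linarith⟩

/-- Both sides have period 16 modulo 32: the binomials enter modulo 8 after the factor 4, and modulo
2 after the factor 16. Sixteen cases remain. -/
theorem choose_congruence_even (m : ℕ) :
    (-1 : ℤ) ^ m * (1 - 4 * (m + 1).choose 2 - 16 * (m * (m + 1).choose 3 + (m + 2).choose 4)) ≡
      2 * m + 1 [ZMOD 32] := by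
  induction m using Nat.strong_induction_on with
  | _ m ih =>
    by_cases hm : m < 16
    · interval_cases m <;> decide
    · obtain ⟨k, rfl⟩ : ∃ k, m = k + 16 := ⟨m - 16, by omega⟩
      obtain ⟨s, hs⟩ := exists_eq_add_mul_of_mod_eq (choose_two_add_sixteen (k + 1))
      obtain ⟨t, ht⟩ := exists_eq_add_mul_of_mod_eq (choose_three_add_sixteen (k + 1))
      obtain ⟨u, hu⟩ := exists_eq_add_mul_of_mod_eq (choose_four_add_sixteen (k + 2))
      rw [show k + 16 + 1 = k + 1 + 16 by ring, show k + 16 + 2 = k + 2 + 16 by ring, hs, ht, hu,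
        pow_add]
      refine Int.ModEq.trans (Int.modEq_iff_dvd.2 ⟨(-1) ^ k * (s + (k + 16) * t +
        8 * (k + 1).choose 3 + u), ?_⟩) ((ih k (by omega)).trans (Int.modEq_iff_dvd.2 ⟨1, ?_⟩))
      · push_cast
        ring
      · push_cast
        ring

theorem choose_congruence_odd (m : ℕ) :
    1 - 4 * ((m + 1).choose 2 : ℤ) - 16 * ((m + 1) * (m + 2).choose 3 + (m + 2).choose 4) ≡
      (-1) ^ m * (2 * m + 1) [ZMOD 32] := by
  induction m using Nat.strong_induction_on with
  | _ m ih =>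
    by_cases hm : m < 16
    · interval_cases m <;> decide
    · obtain ⟨k, rfl⟩ : ∃ k, m = k + 16 := ⟨m - 16, by omega⟩
      obtain ⟨s, hs⟩ := exists_eq_add_mul_of_mod_eq (choose_two_add_sixteen (k + 1))
      obtain ⟨t, ht⟩ := exists_eq_add_mul_of_mod_eq (choose_three_add_sixteen (k + 2))
      obtain ⟨u, hu⟩ := exists_eq_add_mul_of_mod_eq (choose_four_add_sixteen (k + 2))
      rw [show k + 16 + 1 = k + 1 + 16 by ring, show k + 16 + 2 = k + 2 + 16 by ring, hs, ht, hu,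
        pow_add]
      refine Int.ModEq.trans (Int.modEq_iff_dvd.2 ⟨s + (k + 17) * t +
        8 * (k + 2).choose 3 + u, ?_⟩) ((ih k (by omega)).trans (Int.modEq_iff_dvd.2 ⟨(-1) ^ k, ?_⟩))
      · push_cast
        ring
      · push_cast
        ring

/-- The integer whose value as a real number is `chordProduct n`, with its residue modulo `32`. -/
theorem exists_int_eq_chordProduct (n : ℕ) :
    ∃ b : ℤ, (b : ℝ) = chordProduct n ∧ (Even n → b ≡ (n : ℤ) + 1 [ZMOD 32]) ∧
      (Odd n → b ≡ (-1) ^ ((n - 1) / 2) * (n : ℤ) [ZMOD 32]) := by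
  obtain ⟨z, hz⟩ := chordProduct_eq n
  refine ⟨_, hz.symm, ?_, ?_⟩
  · rintro ⟨m, rfl⟩
    rw [← two_mul]
    obtain ⟨⟨a0, a1, a2, a3, a4⟩, -⟩ := chordPoly_coeffs m
    rw [a0, a1, a2, a3, a4]
    have hsq : ((-1 : ℤ) ^ m) ^ 2 = 1 := by rw [← pow_mul, mul_comm, pow_mul]; simp
    have hp : ((-1 : ℤ) ^ m) ^ (2 * m + 1) = (-1) ^ m := by rw [pow_succ, pow_mul, hsq]; simp
    rw [hp]
    -- The remainder `64 z` is `32 · 2z`, so it disappears modulo 32.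
    refine Int.ModEq.trans (Int.modEq_iff_dvd.2 ⟨-(2 * (-1) ^ m * z), ?_⟩)
      ((choose_congruence_even m).trans (by push_cast; rfl))
    generalize (-1 : ℤ) ^ m = w at *
    linear_combination (4 * w * (m + 1).choose 2 + 16 * w * (w ^ 2 + 1) * m * (m + 1).choose 3 + 16 * w * (m + 2).choose 4) * hsq
  · rintro ⟨m, rfl⟩
    obtain ⟨-, a0, a1, a2, a3, a4⟩ := chordPoly_coeffs m
    rw [a0, a1, a2, a3, a4]
    have hsq : ((-1 : ℤ) ^ m) ^ 2 = 1 := by rw [← pow_mul, mul_comm, pow_mul]; simp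
    have hp : ((-1 : ℤ) ^ m) ^ (2 * m + 1 + 1) = 1 := by
      rw [show 2 * m + 1 + 1 = 2 * (m + 1) by ring, pow_mul, hsq]; simp
    rw [hp, show (2 * m + 1 - 1) / 2 = m by omega]
    refine Int.ModEq.trans (Int.modEq_iff_dvd.2 ⟨-(2 * z), ?_⟩)
      ((choose_congruence_odd m).trans (by push_cast; rfl))
    generalize (-1 : ℤ) ^ m = w at *
    linear_combination (4 * (m + 1).choose 2 + 16 * (w ^ 2 + 1) * (m + 1) * (m + 2).choose 3 + 16 * (m + 2).choose 4) * hsq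

/-! ### Kasteleyn's matrix and its spectrum -/

open scoped Kronecker

/-- The adjacency matrix of the path with `m` vertices. -/
def pathMatrix (m : ℕ) : Matrix (Fin m) (Fin m) ℝ :=
  Matrix.of fun i j => if (i : ℕ) + 1 = j ∨ (j : ℕ) + 1 = i then 1 else 0

/-- The diagonal matrix of alternating signs. -/
def signMatrix (m : ℕ) : Matrix (Fin m) (Fin m) ℝ :=
  Matrix.diagonal fun j => (-1) ^ (j : ℕ)

/-- Kasteleyn's signed adjacency matrix of the square lattice: the edges between different rows
carry the sign of their column. -/
def kasteleynMatrix (m : ℕ) : Matrix (Fin m × Fin m) (Fin m × Fin m) ℝ :=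
  pathMatrix m ⊗ₖ signMatrix m + 1 ⊗ₖ pathMatrix m

theorem signMatrix_mul_self (m : ℕ) : signMatrix m * signMatrix m = 1 := by
  rw [signMatrix, Matrix.diagonal_mul_diagonal, ← Matrix.diagonal_one]
  congr 1
  ext j
  rw [← mul_pow]
  simp

/-- Neighbours on a path have opposite parity. This cancels the cross terms in the square of
Kasteleyn's matrix. -/
theorem signMatrix_anticomm (m : ℕ) :
    signMatrix m * pathMatrix m + pathMatrix m * signMatrix m = 0 := by
  ext i j
  rw [Matrix.add_apply, signMatrix, Matrix.diagonal_mul, Matrix.mul_diagonal, pathMatrix,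
    Matrix.of_apply, Matrix.zero_apply]
  split_ifs with h
  · rcases h with h | h <;> rw [← h, pow_succ] <;> ring
  · simp

theorem kasteleynMatrix_sq (m : ℕ) :
    kasteleynMatrix m * kasteleynMatrix m =
      (pathMatrix m * pathMatrix m) ⊗ₖ 1 + 1 ⊗ₖ (pathMatrix m * pathMatrix m) := by
  have h := signMatrix_anticomm m
  rw [kasteleynMatrix, add_mul, mul_add, mul_add, ← Matrix.mul_kronecker_mul, ← Matrix.mul_kronecker_mul,
    ← Matrix.mul_kronecker_mul, ← Matrix.mul_kronecker_mul, signMatrix_mul_self]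
  simp only [one_mul, mul_one]
  have h2 : pathMatrix m ⊗ₖ (signMatrix m * pathMatrix m) +
      pathMatrix m ⊗ₖ (pathMatrix m * signMatrix m) = 0 := by
    rw [← Matrix.kronecker_add, h, Matrix.kronecker_zero]
  rw [add_assoc, ← add_assoc (pathMatrix m ⊗ₖ (signMatrix m * pathMatrix m)), h2, zero_add]

/-- The matrix of discrete sine functions. -/
noncomputable def sineMatrix (m : ℕ) : Matrix (Fin m) (Fin m) ℝ :=
  Matrix.of fun k j => Real.sin (Real.pi * ((k + 1 : ℕ) : ℝ) / (m + 1) * ((j + 1 : ℕ) : ℝ))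

/-- The eigenvalues of the path. -/
noncomputable def pathEigenvalue (m : ℕ) (k : Fin m) : ℝ :=
  2 * Real.cos (Real.pi * ((k + 1 : ℕ) : ℝ) / (m + 1))

/-- The vanishing of `f` at `0` and `m + 1` supplies the neighbours missing at the ends of the path.
-/
theorem sum_mul_pathMatrix {m : ℕ} (f : ℕ → ℝ) (h0 : f 0 = 0) (hm : f (m + 1) = 0) (j : Fin m) :
    ∑ i : Fin m, f (i + 1) * pathMatrix m i j = f j + f (j + 2) := by
  have h : ∀ i : Fin m, f (i + 1) * pathMatrix m i j =
      (if (i : ℕ) + 1 = j then f j else 0) + (if (i : ℕ) = j + 1 then f (j + 2) else 0) := by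
    intro i
    simp only [pathMatrix, Matrix.of_apply]
    by_cases h1 : (i : ℕ) + 1 = j
    · simp [h1, show ¬ (i : ℕ) = j + 1 by omega]
    · by_cases h2 : (i : ℕ) = j + 1
      · simp [h2, show ¬ (j : ℕ) + 1 + 1 = j by omega]
      · simp [h1, h2, show ¬ (j : ℕ) + 1 = i by omega]
  rw [Finset.sum_congr rfl fun i _ => h i, Finset.sum_add_distrib]
  congr 1
  · rcases Nat.eq_zero_or_pos (j : ℕ) with hj | hj
    · rw [hj, h0]; simp
    · rw [Finset.sum_eq_single (⟨j - 1, by omega⟩ : Fin m)]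
      · rw [if_pos]; simp; omega
      · intro b _ hb
        rw [if_neg]
        intro hb'
        exact hb (Fin.ext (by simp; omega))
      · simp
  · by_cases hj : (j : ℕ) + 1 < m
    · rw [Finset.sum_eq_single (⟨j + 1, hj⟩ : Fin m)]
      · simp
      · intro b _ hb
        rw [if_neg]
        intro hb'
        exact hb (Fin.ext (by simp; omega))
      · simp
    · rw [show (j : ℕ) + 2 = m + 1 by omega, hm]; simp

theorem sineMatrix_mul_pathMatrix (m : ℕ) :
    sineMatrix m * pathMatrix m = Matrix.diagonal (pathEigenvalue m) * sineMatrix m := by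
  ext k j
  rw [Matrix.mul_apply, Matrix.diagonal_mul]
  set θ : ℝ := Real.pi * ((k + 1 : ℕ) : ℝ) / (m + 1) with hθ
  have hm : (m + 1 : ℝ) ≠ 0 := by positivity
  have h := sum_mul_pathMatrix (m := m) (fun i => Real.sin (θ * i)) (by simp) (by
    have : θ * ((m + 1 : ℕ) : ℝ) = ((k + 1 : ℕ) : ℝ) * Real.pi := by
      rw [hθ]; push_cast; field_simp
    simp only [this]
    exact Real.sin_nat_mul_pi _) j
  refine Eq.trans (by rfl) (h.trans ?_)
  simp only [pathEigenvalue, sineMatrix, Matrix.of_apply, ← hθ]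
  push_cast
  rw [show θ * ((j : ℝ) + 2) = θ * (j + 1) + θ by ring, show θ * (j : ℝ) = θ * (j + 1) - θ by ring,
    Real.sin_add, Real.sin_sub]
  ring

theorem pathEigenvalue_injective (m : ℕ) : Function.Injective (pathEigenvalue m) := by
  intro i j h
  have hN : (0 : ℝ) < m + 1 := by positivity
  have hmem : ∀ i : Fin m, Real.pi * ((i + 1 : ℕ) : ℝ) / (m + 1) ∈ Set.Icc 0 Real.pi := by
    intro i
    refine ⟨by positivity, ?_⟩
    rw [div_le_iff₀ hN]
    have : ((i + 1 : ℕ) : ℝ) ≤ m := by exact_mod_cast i.2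
    nlinarith [Real.pi_pos]
  have h2 := Real.injOn_cos (hmem i) (hmem j) (by simpa [pathEigenvalue] using h)
  have hpi := Real.pi_ne_zero
  field_simp at h2
  have h3 : (i : ℕ) + 1 = j + 1 := by exact_mod_cast h2
  exact Fin.ext (by omega)

theorem pathMatrix_transpose (m : ℕ) : (pathMatrix m).transpose = pathMatrix m := by
  ext i j
  simp [pathMatrix, or_comm]

/-- With `V` the sine matrix, `V Vᵀ` commutes with a diagonal matrix with distinct entries, so it is
diagonal. Its diagonal entries are sums of squares whose first term is positive. -/
theorem det_sineMatrix_ne_zero (m : ℕ) : (sineMatrix m).det ≠ 0 := by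
  have h1 := sineMatrix_mul_pathMatrix m
  have h2 := congrArg Matrix.transpose h1
  rw [Matrix.transpose_mul, Matrix.transpose_mul, pathMatrix_transpose, Matrix.diagonal_transpose] at h2
  set V := sineMatrix m
  have h3 : (V * V.transpose) * Matrix.diagonal (pathEigenvalue m) =
      Matrix.diagonal (pathEigenvalue m) * (V * V.transpose) := by
    rw [Matrix.mul_assoc, ← h2, ← Matrix.mul_assoc, h1, Matrix.mul_assoc]
  have hdiag : V * V.transpose = Matrix.diagonal fun k => (V * V.transpose) k k := by
    ext k l
    by_cases hkl : k = l
    · subst hkl; simp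
    · rw [Matrix.diagonal_apply_ne _ hkl]
      have := congrFun (congrFun h3 k) l
      rw [Matrix.mul_diagonal, Matrix.diagonal_mul] at this
      have h4 : (V * V.transpose) k l * (pathEigenvalue m l - pathEigenvalue m k) = 0 := by
        linear_combination this
      refine (mul_eq_zero.1 h4).resolve_right fun h5 => hkl ?_
      exact (pathEigenvalue_injective m (sub_eq_zero.1 h5)).symm
  have hdet : (V * V.transpose).det ≠ 0 := by
    rw [hdiag, Matrix.det_diagonal]
    refine Finset.prod_ne_zero_iff.2 fun k _ => ?_
    have hm : 0 < m := by have := k.2; omega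
    have hpos : 0 < V k ⟨0, hm⟩ := by
      have hN : (0 : ℝ) < m + 1 := by positivity
      have hpi := Real.pi_pos
      have hk : ((k + 1 : ℕ) : ℝ) ≤ m := by exact_mod_cast k.2
      simp only [V, sineMatrix, Matrix.of_apply]
      refine Real.sin_pos_of_pos_of_lt_pi (by positivity) ?_
      rw [zero_add, Nat.cast_one, mul_one, div_lt_iff₀ hN]
      nlinarith
    rw [Matrix.mul_apply]
    refine (lt_of_lt_of_le (mul_pos hpos hpos) ?_).ne'
    exact Finset.single_le_sum (f := fun j => V k j * V.transpose j k)
      (fun j _ => mul_self_nonneg (V k j)) (Finset.mem_univ (⟨0, hm⟩ : Fin m))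
  rw [Matrix.det_mul] at hdet
  exact left_ne_zero_of_mul hdet

theorem det_kasteleynMatrix_sq (m : ℕ) :
    (kasteleynMatrix m).det ^ 2 = ∏ k, ∏ l, (pathEigenvalue m k ^ 2 + pathEigenvalue m l ^ 2) := by
  have h1 := sineMatrix_mul_pathMatrix m
  have h2 : sineMatrix m * (pathMatrix m * pathMatrix m) =
      Matrix.diagonal (fun k => pathEigenvalue m k ^ 2) * sineMatrix m := by
    rw [← Matrix.mul_assoc, h1, Matrix.mul_assoc, h1, ← Matrix.mul_assoc, Matrix.diagonal_mul_diagonal]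
    simp only [sq]
  have h3 : (sineMatrix m ⊗ₖ sineMatrix m) * (kasteleynMatrix m * kasteleynMatrix m) =
      Matrix.diagonal (fun p : Fin m × Fin m => pathEigenvalue m p.1 ^ 2 + pathEigenvalue m p.2 ^ 2) *
        (sineMatrix m ⊗ₖ sineMatrix m) := by
    have h4 : Matrix.diagonal (fun p : Fin m × Fin m => pathEigenvalue m p.1 ^ 2 + pathEigenvalue m p.2 ^ 2) =
        Matrix.diagonal (fun k => pathEigenvalue m k ^ 2) ⊗ₖ 1 +
          1 ⊗ₖ Matrix.diagonal (fun k => pathEigenvalue m k ^ 2) := by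
      rw [← Matrix.diagonal_one, Matrix.diagonal_kronecker_diagonal, Matrix.diagonal_kronecker_diagonal,
        Matrix.diagonal_add]
      simp
    rw [kasteleynMatrix_sq, h4, mul_add, add_mul, ← Matrix.mul_kronecker_mul, ← Matrix.mul_kronecker_mul,
      ← Matrix.mul_kronecker_mul, ← Matrix.mul_kronecker_mul, h2]
    simp only [one_mul, mul_one]
  have h5 := congrArg Matrix.det h3
  have hV : (sineMatrix m ⊗ₖ sineMatrix m).det ≠ 0 := by
    rw [Matrix.det_kronecker]
    exact mul_ne_zero (pow_ne_zero _ (det_sineMatrix_ne_zero m)) (pow_ne_zero _ (det_sineMatrix_ne_zero m))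
  rw [Matrix.det_mul, Matrix.det_mul, Matrix.det_mul, mul_comm] at h5
  rw [sq, mul_right_cancel₀ hV h5, Matrix.det_diagonal, Fintype.prod_prod_type]

theorem pathEigenvalue_sq (n : ℕ) (k : Fin (2 * n)) :
    pathEigenvalue (2 * n) k ^ 2 = 2 + chord n (k + 1 : ℕ) := by
  rw [pathEigenvalue, chord_natCast, mul_pow, Real.cos_sq]
  push_cast
  rw [show 2 * (Real.pi * ((k : ℝ) + 1) / (2 * n + 1)) = 2 * Real.pi * (k + 1) / (2 * n + 1) by ring]
  ring

theorem abs_det_kasteleynMatrix (n : ℕ) :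
    |(kasteleynMatrix (2 * n)).det| = (2 ^ n * chordProduct n ^ 2) ^ 2 := by
  refine (pow_left_inj₀ (abs_nonneg _) (by positivity) two_ne_zero).1 ?_
  rw [sq_abs, det_kasteleynMatrix_sq, ← pow_mul, ← prod_prod_four_add_chord]
  refine Finset.prod_congr rfl fun k _ => Finset.prod_congr rfl fun l _ => ?_
  rw [pathEigenvalue_sq, pathEigenvalue_sq]
  ring

/-! ### Perfect matchings as involutions, and pairs of them as permutations -/

/-- A permutation that swaps the two ends of every edge of a perfect matching. -/
def IsPairing {V : Type*} (G : SimpleGraph V) (f : Equiv.Perm V) : Prop :=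
  ∀ c, G.Adj c (f c) ∧ f (f c) = c

theorem ncard_isPerfectMatching_eq {V : Type*} (G : SimpleGraph V) :
    Set.ncard {M : G.Subgraph | M.IsPerfectMatching} = Nat.card {f // IsPairing G f} := by
  rw [← Nat.card_coe_set_eq]
  symm
  refine Nat.card_congr (Equiv.ofBijective
    (fun f => ⟨{ verts := Set.univ
                 Adj := fun c d => f.1 c = d
                 adj_sub := fun {c d} h => h ▸ (f.2 c).1
                 edge_vert := fun _ => Set.mem_univ _
                 symm := ⟨fun c d h => by rw [← h, (f.2 c).2]⟩ }, ?_⟩) ⟨?_, ?_⟩)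
  · rw [Set.mem_ofPred_eq, SimpleGraph.Subgraph.isPerfectMatching_iff]
    exact fun v => ⟨f.1 v, rfl, fun w h => (show f.1 v = w from h).symm⟩
  · rintro f g h
    have h' := congrArg (fun M => M.1.Adj) h
    refine Subtype.ext (Equiv.ext fun c => ?_)
    have h2 := congrFun (congrFun h' c) (f.1 c)
    simpa [eq_comm] using h2
  · rintro ⟨M, hM⟩
    have hM' := SimpleGraph.Subgraph.isPerfectMatching_iff.1 hM
    choose f hf hf' using hM'
    have hff : ∀ c, f (f c) = c := fun c => (hf' (f c) c (hf c).symm).symm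
    refine ⟨⟨⟨f, f, hff, hff⟩, fun c => ⟨M.adj_sub (hf c), hff c⟩⟩, Subtype.ext ?_⟩
    refine SimpleGraph.Subgraph.ext ?_ ?_
    · exact (SimpleGraph.Subgraph.isSpanning_iff.1 hM.2).symm
    · ext c d
      exact ⟨fun h => by rw [← show f c = d from h]; exact hf c, fun h => (hf' c d h).symm⟩

section Combine

variable {V : Type*} {G : SimpleGraph V}

theorem adj_inv_of_adj {g : Equiv.Perm V} (hg : ∀ c, G.Adj c (g c)) (c : V) : G.Adj c (g⁻¹ c) := by
  have := hg (g⁻¹ c)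
  rw [show g (g⁻¹ c) = c from g.apply_symm_apply c] at this
  exact this.symm

variable (color : V → Bool) (hcolor : ∀ c d, G.Adj c d → color c ≠ color d)

/-- The permutation that follows `f` on one colour class and `h` on the other one. -/
def combinePairings (f h : {f // IsPairing G f}) : Equiv.Perm V where
  toFun c := if color c then f.1 c else h.1 c
  invFun c := if color c then h.1 c else f.1 c
  left_inv c := by
    have h1 := hcolor _ _ (f.2 c).1
    have h2 := hcolor _ _ (h.2 c).1
    have h3 := (f.2 c).2
    have h4 := (h.2 c).2
    cases hc : color c <;> simp_all
  right_inv c := by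
    have h1 := hcolor _ _ (f.2 c).1
    have h2 := hcolor _ _ (h.2 c).1
    have h3 := (f.2 c).2
    have h4 := (h.2 c).2
    cases hc : color c <;> simp_all

theorem combinePairings_apply (f h : {f // IsPairing G f}) (c : V) :
    combinePairings color hcolor f h c = if color c then f.1 c else h.1 c := rfl

theorem combinePairings_inv (f h : {f // IsPairing G f}) :
    (combinePairings color hcolor f h)⁻¹ = combinePairings color hcolor h f := rfl

theorem adj_combinePairings (f h : {f // IsPairing G f}) (c : V) :
    G.Adj c (combinePairings color hcolor f h c) := by
  rw [combinePairings_apply]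
  split_ifs
  exacts [(f.2 c).1, (h.2 c).1]

/-- The first of the two perfect matchings whose union is the set of edges `{c, g c}`. -/
def splitPairing (g : Equiv.Perm V) (hg : ∀ c, G.Adj c (g c)) : {f // IsPairing G f} :=
  have hinv := adj_inv_of_adj hg
  have hff : ∀ c, (if color (if color c then g c else g⁻¹ c) then g (if color c then g c else g⁻¹ c)
      else g⁻¹ (if color c then g c else g⁻¹ c)) = c := fun c => by
    have h1 := hcolor _ _ (hg c)
    have h2 := hcolor _ _ (hinv c)
    cases hc : color c <;> simp_all
  ⟨⟨fun c => if color c then g c else g⁻¹ c, fun c => if color c then g c else g⁻¹ c, hff, hff⟩,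
    fun c => ⟨by
      change G.Adj c (if color c then g c else g⁻¹ c)
      split_ifs
      exacts [hg c, hinv c], hff c⟩⟩

theorem splitPairing_apply (g : Equiv.Perm V) (hg : ∀ c, G.Adj c (g c)) (c : V) :
    (splitPairing color hcolor g hg).1 c = if color c then g c else g⁻¹ c := rfl

/-- Permutations all of whose arrows are edges correspond to pairs of perfect matchings. -/
def pairingPairsEquiv : {f // IsPairing G f} × {f // IsPairing G f} ≃
    {g : Equiv.Perm V // ∀ c, G.Adj c (g c)} where
  toFun p := ⟨combinePairings color hcolor p.1 p.2, adj_combinePairings color hcolor p.1 p.2⟩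
  invFun g := (splitPairing color hcolor g.1 g.2,
    splitPairing color hcolor g.1⁻¹ (adj_inv_of_adj g.2))
  left_inv p := by
    refine Prod.ext (Subtype.ext (Equiv.ext fun c => ?_)) (Subtype.ext (Equiv.ext fun c => ?_)) <;>
    · simp only [splitPairing_apply, combinePairings_inv, combinePairings_apply]
      split_ifs <;> rfl
  right_inv g := by
    refine Subtype.ext (Equiv.ext fun c => ?_)
    simp only [combinePairings_apply, splitPairing_apply, inv_inv]
    split_ifs <;> rfl

end Combine

/-! ### Determinant terms and their invariance under flips -/

section DetTerm

variable {V : Type*} [Fintype V] [DecidableEq V] (M : Matrix V V ℝ)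

/-- The summand of the determinant that belongs to a permutation. -/
def detTerm (σ : Equiv.Perm V) : ℝ :=
  (Equiv.Perm.sign σ : ℤ) * ∏ c, M (σ c) c

theorem detTerm_inv (hM : ∀ c d, M c d = M d c) (σ : Equiv.Perm V) : detTerm M σ⁻¹ = detTerm M σ := by
  rw [detTerm, detTerm, Equiv.Perm.sign_inv]
  congr 1
  rw [← Equiv.prod_comp σ]
  refine Finset.prod_congr rfl fun c _ => ?_
  rw [show σ⁻¹ (σ c) = c from σ.symm_apply_apply c, hM]

/-- The transposition changes the sign of the permutation, and the hypothesis says that it also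
changes the sign of the product of weights. -/
theorem detTerm_mul_swap {σ : Equiv.Perm V} {a b : V} (hab : a ≠ b)
    (h : M (σ b) a * M (σ a) b = -(M (σ a) a * M (σ b) b)) :
    detTerm M (σ * Equiv.swap a b) = detTerm M σ := by
  have hb : b ∈ Finset.univ.erase a := Finset.mem_erase.2 ⟨hab.symm, Finset.mem_univ b⟩
  rw [detTerm, detTerm, Equiv.Perm.sign_mul, Equiv.Perm.sign_swap hab,
    ← Finset.mul_prod_erase _ _ (Finset.mem_univ a), ← Finset.mul_prod_erase _ _ hb,
    ← Finset.mul_prod_erase _ _ (Finset.mem_univ a), ← Finset.mul_prod_erase _ _ hb]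
  have hrest : ∏ c ∈ (Finset.univ.erase a).erase b, M ((σ * Equiv.swap a b) c) c =
      ∏ c ∈ (Finset.univ.erase a).erase b, M (σ c) c := by
    refine Finset.prod_congr rfl fun c hc => ?_
    rw [Equiv.Perm.mul_apply, Equiv.swap_apply_of_ne_of_ne]
    · exact fun h => by simp [h] at hc
    · exact fun h => by simp [h] at hc
  rw [hrest, Equiv.Perm.mul_apply, Equiv.Perm.mul_apply, Equiv.swap_apply_left, Equiv.swap_apply_right]
  push_cast
  linear_combination (-((Equiv.Perm.sign σ : ℤ) : ℝ) * ∏ c ∈ (Finset.univ.erase a).erase b, M (σ c) c) * h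

theorem abs_det_eq_card {G : SimpleGraph V} (hM : ∀ c d, M c d = M d c)
    (hM0 : ∀ c d, ¬ G.Adj c d → M c d = 0) (hM1 : ∀ c d, G.Adj c d → |M c d| = 1)
    (hconst : ∀ σ τ : Equiv.Perm V, (∀ c, G.Adj c (σ c)) → (∀ c, G.Adj c (τ c)) →
      detTerm M σ = detTerm M τ) :
    |M.det| = Nat.card {g : Equiv.Perm V // ∀ c, G.Adj c (g c)} := by
  classical
  have hdet : M.det = ∑ σ : Equiv.Perm V, if ∀ c, G.Adj c (σ c) then detTerm M σ else 0 := by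
    rw [Matrix.det_apply']
    refine Finset.sum_congr rfl fun σ _ => ?_
    split_ifs with h
    · rfl
    · obtain ⟨c, hc⟩ := not_forall.1 h
      rw [Finset.prod_eq_zero (Finset.mem_univ c) (by rw [hM, hM0 _ _ hc]), mul_zero]
  rw [hdet, ← Finset.sum_filter, Nat.card_eq_fintype_card, Fintype.card_subtype]
  rcases (Finset.univ.filter fun σ : Equiv.Perm V => ∀ c, G.Adj c (σ c)).eq_empty_or_nonempty with h | ⟨τ, hτ⟩
  · rw [h]; simp
  · rw [Finset.sum_congr rfl fun σ hσ => hconst σ τ (Finset.mem_filter.1 hσ).2 (Finset.mem_filter.1 hτ).2,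
      Finset.sum_const, nsmul_eq_mul, abs_mul, Nat.abs_cast]
    have h1 : |detTerm M τ| = 1 := by
      rw [detTerm, abs_mul, Finset.abs_prod, Finset.prod_eq_one, mul_one]
      · rcases Int.units_eq_one_or (Equiv.Perm.sign τ) with h | h <;> simp [h]
      · intro c _
        rw [hM]
        exact hM1 _ _ ((Finset.mem_filter.1 hτ).2 c)
    rw [h1, mul_one]

end DetTerm

section Flip

variable {V : Type*} [DecidableEq V] {G : SimpleGraph V} (M : V → V → ℝ)

/-- `f'` arises from `f` by replacing two opposite edges of a `4`-cycle by the two other ones, where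
the product of the weights of the four edges has the sign that Kasteleyn's condition requires. -/
def IsFlip (f f' : {f // IsPairing G f}) : Prop :=
  ∃ a b a' b' : V, f.1 a = b ∧ f.1 a' = b' ∧ G.Adj a a' ∧ G.Adj b b' ∧ a ≠ b' ∧ a' ≠ b ∧
    M a b * M a' b' = -(M a a' * M b b') ∧
    f'.1 = f.1 * Equiv.swap a b' * Equiv.swap a' b

theorem exists_isFlip (f : {f // IsPairing G f}) {a b a' b' : V} (h1 : f.1 a = b) (h2 : f.1 a' = b')
    (h3 : G.Adj a a') (h4 : G.Adj b b') (h5 : a ≠ b') (h6 : a' ≠ b)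
    (h7 : M a b * M a' b' = -(M a a' * M b b')) :
    ∃ f' : {f // IsPairing G f}, IsFlip M f f' ∧ f'.1 a = a' ∧ f'.1 b = b' ∧
      ∀ c, c ≠ a → c ≠ b → c ≠ a' → c ≠ b' → f'.1 c = f.1 c := by
  have g1 : f.1 b = a := by rw [← h1, (f.2 a).2]
  have g2 : f.1 b' = a' := by rw [← h2, (f.2 a').2]
  have hab : a ≠ b := fun h => (f.2 a).1.ne (by rw [h1, h])
  have hab' : a' ≠ b' := fun h => (f.2 a').1.ne (by rw [h2, h])
  have haa := h3.ne
  have hbb := h4.ne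
  set F : Equiv.Perm V := f.1 * Equiv.swap a b' * Equiv.swap a' b with hF
  have e1 : F a = a' := by
    rw [hF, Equiv.Perm.mul_apply, Equiv.Perm.mul_apply, Equiv.swap_apply_of_ne_of_ne haa hab,
      Equiv.swap_apply_left, g2]
  have e2 : F b = b' := by
    rw [hF, Equiv.Perm.mul_apply, Equiv.Perm.mul_apply, Equiv.swap_apply_right,
      Equiv.swap_apply_of_ne_of_ne haa.symm hab', h2]
  have e3 : F a' = a := by
    rw [hF, Equiv.Perm.mul_apply, Equiv.Perm.mul_apply, Equiv.swap_apply_left,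
      Equiv.swap_apply_of_ne_of_ne hab.symm hbb, g1]
  have e4 : F b' = b := by
    rw [hF, Equiv.Perm.mul_apply, Equiv.Perm.mul_apply,
      Equiv.swap_apply_of_ne_of_ne hab'.symm hbb.symm, Equiv.swap_apply_right, h1]
  have e5 : ∀ c, c ≠ a → c ≠ b → c ≠ a' → c ≠ b' → F c = f.1 c := by
    intro c ha hb ha' hb'
    rw [hF, Equiv.Perm.mul_apply, Equiv.Perm.mul_apply, Equiv.swap_apply_of_ne_of_ne ha' hb,
      Equiv.swap_apply_of_ne_of_ne ha hb']
  have hpair : IsPairing G F := by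
    intro c
    by_cases ha : c = a
    · rw [ha, e1, e3]; exact ⟨h3, rfl⟩
    by_cases hb : c = b
    · rw [hb, e2, e4]; exact ⟨h4, rfl⟩
    by_cases ha' : c = a'
    · rw [ha', e3, e1]; exact ⟨h3.symm, rfl⟩
    by_cases hb' : c = b'
    · rw [hb', e4, e2]; exact ⟨h4.symm, rfl⟩
    rw [e5 c ha hb ha' hb', e5, (f.2 c).2]
    · exact ⟨(f.2 c).1, rfl⟩
    · rintro rfl; exact hb (by rw [← h1, (f.2 c).2])
    · rintro rfl; exact ha (by rw [← g1, (f.2 c).2])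
    · rintro rfl; exact hb' (by rw [← h2, (f.2 c).2])
    · rintro rfl; exact ha' (by rw [← g2, (f.2 c).2])
  exact ⟨⟨F, hpair⟩, ⟨a, b, a', b', h1, h2, h3, h4, h5, h6, h7, rfl⟩, e1, e2, e5⟩

variable [Fintype V] {M}
  (color : V → Bool) (hcolor : ∀ c d, G.Adj c d → color c ≠ color d)

/-- Of the two transpositions in a flip, one exchanges squares of colour `true` and the other
squares of colour `false`. The combined permutation follows `f` only on `true`, so it changes by a
single transposition and `detTerm_mul_swap` applies. -/
theorem detTerm_combinePairings_of_isFlip (hM : ∀ c d, M c d = M d c) {f f' : {f // IsPairing G f}}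
    (h : {f // IsPairing G f}) (hf : IsFlip M f f') :
    detTerm (Matrix.of M) (combinePairings color hcolor f' h) =
      detTerm (Matrix.of M) (combinePairings color hcolor f h) := by
  obtain ⟨a, b, a', b', h1, h2, h3, h4, h5, h6, h7, h8⟩ := hf
  have g1 : f.1 b = a := by rw [← h1, (f.2 a).2]
  have g2 : f.1 b' = a' := by rw [← h2, (f.2 a').2]
  have hab : a ≠ b := fun h => (f.2 a).1.ne (by rw [h1, h])
  have hab' : a' ≠ b' := fun h => (f.2 a').1.ne (by rw [h2, h])
  have haa := h3.ne
  have hbb := h4.ne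
  have c1 := hcolor _ _ h3
  have c2 := hcolor _ _ h4
  have c3 : color a ≠ color b := by rw [← h1]; exact hcolor _ _ (f.2 a).1
  cases hc : color a
  · have cb : color b = true := by simpa [hc] using c3
    have ca' : color a' = true := by simpa [hc] using c1
    have cb' : color b' = false := by simpa [cb] using c2
    have key : combinePairings color hcolor f' h =
        combinePairings color hcolor f h * Equiv.swap a' b := by
      ext c
      rw [Equiv.Perm.mul_apply, combinePairings_apply, combinePairings_apply]
      cases hcc : color c
      · have n1 : c ≠ a' := fun h => by simp [h, ca'] at hcc
        have n2 : c ≠ b := fun h => by simp [h, cb] at hcc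
        rw [Equiv.swap_apply_of_ne_of_ne n1 n2, hcc]
        simp
      · have n1 : c ≠ a := fun h => by simp [h, hc] at hcc
        have n2 : c ≠ b' := fun h => by simp [h, cb'] at hcc
        have n3 : color (Equiv.swap a' b c) = true := by
          rw [Equiv.swap_apply_def]; split_ifs <;> assumption
        have n4 : Equiv.swap a b' (Equiv.swap a' b c) = Equiv.swap a' b c := by
          refine Equiv.swap_apply_of_ne_of_ne (fun h => ?_) (fun h => ?_)
          · rw [h, hc] at n3; simp at n3
          · rw [h, cb'] at n3; simp at n3
        rw [h8, n3]
        simp [n4]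
    rw [key]
    refine detTerm_mul_swap _ h6 ?_
    simp only [combinePairings_apply, cb, ca', if_true, g1, h2, Matrix.of_apply]
    rw [hM b' b, hM b' a', mul_comm (M a' b'), h7, neg_neg]
  · have cb : color b = false := by simpa [hc] using c3
    have ca' : color a' = false := by simpa [hc] using c1
    have cb' : color b' = true := by simpa [cb] using c2
    have key : combinePairings color hcolor f' h =
        combinePairings color hcolor f h * Equiv.swap a b' := by
      ext c
      rw [Equiv.Perm.mul_apply, combinePairings_apply, combinePairings_apply]
      cases hcc : color c
      · have n1 : c ≠ a := fun h => by simp [h, hc] at hcc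
        have n2 : c ≠ b' := fun h => by simp [h, cb'] at hcc
        rw [Equiv.swap_apply_of_ne_of_ne n1 n2, hcc]
        simp
      · have n1 : c ≠ a' := fun h => by simp [h, ca'] at hcc
        have n2 : c ≠ b := fun h => by simp [h, cb] at hcc
        have n3 : color (Equiv.swap a b' c) = true := by
          rw [Equiv.swap_apply_def]; split_ifs <;> assumption
        rw [h8, n3]
        simp [Equiv.swap_apply_of_ne_of_ne n1 n2]
    rw [key]
    refine detTerm_mul_swap _ h5 ?_
    simp only [combinePairings_apply, cb', hc, if_true, g2, h1, Matrix.of_apply]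
    rw [hM a' a, hM b a, h7, neg_neg]

theorem detTerm_combinePairings_of_reflTransGen (hM : ∀ c d, M c d = M d c)
    {f f' : {f // IsPairing G f}} (h : {f // IsPairing G f})
    (hf : Relation.ReflTransGen (IsFlip M) f f') :
    detTerm (Matrix.of M) (combinePairings color hcolor f' h) =
      detTerm (Matrix.of M) (combinePairings color hcolor f h) := by
  induction hf with
  | refl => rfl
  | tail _ h1 ih => rw [detTerm_combinePairings_of_isFlip color hcolor hM h h1, ih]

end Flip

/-- If any two perfect matchings of a bipartite graph can be joined by flips, then the determinant
of the signed adjacency matrix is, up to sign, the square of their number. -/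
theorem abs_det_eq_card_pairings_sq {V : Type*} [DecidableEq V] [Fintype V] {G : SimpleGraph V}
    {M : V → V → ℝ} (color : V → Bool) (hcolor : ∀ c d, G.Adj c d → color c ≠ color d)
    (hM : ∀ c d, M c d = M d c)
    (hM0 : ∀ c d, ¬ G.Adj c d → M c d = 0) (hM1 : ∀ c d, G.Adj c d → |M c d| = 1)
    (hflip : ∀ f f' : {f // IsPairing G f}, Relation.Join (Relation.ReflTransGen (IsFlip M)) f f') :
    |(Matrix.of M).det| = (Nat.card {f // IsPairing G f} : ℝ) ^ 2 := by
  have hleft : ∀ f f' h : {f // IsPairing G f},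
      detTerm (Matrix.of M) (combinePairings color hcolor f h) =
        detTerm (Matrix.of M) (combinePairings color hcolor f' h) := by
    intro f f' h
    obtain ⟨g, h1, h2⟩ := hflip f f'
    rw [← detTerm_combinePairings_of_reflTransGen color hcolor hM h h1,
      detTerm_combinePairings_of_reflTransGen color hcolor hM h h2]
  have hterm : ∀ f h f' h' : {f // IsPairing G f},
      detTerm (Matrix.of M) (combinePairings color hcolor f h) =
        detTerm (Matrix.of M) (combinePairings color hcolor f' h') := by
    intro f h f' h'
    -- Inversion exchanges the two matchings of a pair, so invariance in the first argument gives
    -- invariance in the second.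
    have hswap : ∀ f h : {f // IsPairing G f},
        detTerm (Matrix.of M) (combinePairings color hcolor f h) =
          detTerm (Matrix.of M) (combinePairings color hcolor h f) :=
      fun f h => (detTerm_inv (Matrix.of M) hM _).symm
    rw [hleft f f' h, hswap f' h, hleft h h' f', hswap]
  rw [abs_det_eq_card (Matrix.of M) hM hM0 hM1, ← Nat.card_congr (pairingPairsEquiv color hcolor),
    Nat.card_prod, Nat.cast_mul, sq]
  intro σ τ hσ hτ
  obtain ⟨p, hp⟩ := (pairingPairsEquiv color hcolor).surjective ⟨σ, hσ⟩
  obtain ⟨q, hq⟩ := (pairingPairsEquiv color hcolor).surjective ⟨τ, hτ⟩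
  rw [← show _ = σ from congrArg Subtype.val hp, ← show _ = τ from congrArg Subtype.val hq]
  exact hterm p.1 p.2 q.1 q.2

/-! ### Flips on the square board -/

theorem squareLattice_adj {m : ℕ} (p q : Fin m × Fin m) :
    (squareLattice m).Adj p q ↔
      (p.1 = q.1 ∧ ((p.2 : ℕ) + 1 = q.2 ∨ (q.2 : ℕ) + 1 = p.2)) ∨
      (p.2 = q.2 ∧ ((p.1 : ℕ) + 1 = q.1 ∨ (q.1 : ℕ) + 1 = p.1)) := by
  rw [squareLattice, SimpleGraph.boxProd_adj, SimpleGraph.pathGraph_adj, SimpleGraph.pathGraph_adj]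
  tauto

theorem kasteleynMatrix_apply {m : ℕ} (p q : Fin m × Fin m) :
    kasteleynMatrix m p q =
      (if p.1 = q.1 ∧ ((p.2 : ℕ) + 1 = q.2 ∨ (q.2 : ℕ) + 1 = p.2) then 1 else 0) +
      (if p.2 = q.2 ∧ ((p.1 : ℕ) + 1 = q.1 ∨ (q.1 : ℕ) + 1 = p.1) then (-1) ^ (p.2 : ℕ) else 0) := by
  obtain ⟨i, j⟩ := p
  obtain ⟨k, l⟩ := q
  rw [kasteleynMatrix, Matrix.add_apply, Matrix.kronecker_apply, Matrix.kronecker_apply, add_comm]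
  simp only [pathMatrix, signMatrix, Matrix.of_apply, Matrix.one_apply, Matrix.diagonal_apply]
  congr 1
  · by_cases h : i = k <;> simp [h]
  · by_cases h : j = l <;> simp [h]

theorem kasteleynMatrix_symm {m : ℕ} (p q : Fin m × Fin m) :
    kasteleynMatrix m p q = kasteleynMatrix m q p := by
  rw [kasteleynMatrix_apply, kasteleynMatrix_apply]
  congr 1
  · simp only [eq_comm, or_comm]
  · by_cases h : p.2 = q.2
    · simp only [h, or_comm]
    · simp [h, Ne.symm h]

theorem kasteleynMatrix_horizontal {m : ℕ} (i : Fin m) {j j' : Fin m} (h : (j' : ℕ) = j + 1) :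
    kasteleynMatrix m (i, j) (i, j') = 1 := by
  rw [kasteleynMatrix_apply, if_pos ⟨rfl, Or.inl h.symm⟩, if_neg, add_zero]
  rintro ⟨h1, -⟩
  have : j = j' := h1
  subst this
  omega

theorem kasteleynMatrix_vertical {m : ℕ} {i i' : Fin m} (j : Fin m) (h : (i' : ℕ) = i + 1) :
    kasteleynMatrix m (i, j) (i', j) = (-1) ^ (j : ℕ) := by
  rw [kasteleynMatrix_apply, if_neg, if_pos ⟨rfl, Or.inl h.symm⟩, zero_add]
  rintro ⟨h1, -⟩
  have : i = i' := h1
  subst this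
  omega

theorem kasteleynMatrix_eq_zero {m : ℕ} (p q : Fin m × Fin m) (h : ¬ (squareLattice m).Adj p q) :
    kasteleynMatrix m p q = 0 := by
  rw [squareLattice_adj, not_or] at h
  rw [kasteleynMatrix_apply, if_neg h.1, if_neg h.2, add_zero]

theorem abs_kasteleynMatrix {m : ℕ} (p q : Fin m × Fin m) (h : (squareLattice m).Adj p q) :
    |kasteleynMatrix m p q| = 1 := by
  obtain ⟨i, j⟩ := p
  obtain ⟨k, l⟩ := q
  rw [squareLattice_adj] at h
  dsimp only at h
  rcases h with ⟨rfl, h | h⟩ | ⟨rfl, h | h⟩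
  · rw [kasteleynMatrix_horizontal i h.symm, abs_one]
  · rw [kasteleynMatrix_symm, kasteleynMatrix_horizontal i h.symm, abs_one]
  · rw [kasteleynMatrix_vertical j h.symm]; simp
  · rw [kasteleynMatrix_symm, kasteleynMatrix_vertical j h.symm]; simp

theorem adj_horizontal {m : ℕ} (i : Fin m) {j j' : Fin m} (h : (j' : ℕ) = j + 1) :
    (squareLattice m).Adj (i, j) (i, j') :=
  (squareLattice_adj _ _).2 (Or.inl ⟨rfl, Or.inl h.symm⟩)

theorem adj_vertical {m : ℕ} {i i' : Fin m} (j : Fin m) (h : (i' : ℕ) = i + 1) :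
    (squareLattice m).Adj (i, j) (i', j) :=
  (squareLattice_adj _ _).2 (Or.inr ⟨rfl, Or.inl h.symm⟩)

theorem fst_ne_of_eq_succ {m : ℕ} {i i' j j' : Fin m} (h : (i' : ℕ) = i + 1) : (i, j) ≠ (i', j') :=
  fun e => by
    have : i = i' := congrArg Prod.fst e
    subst this
    omega

theorem snd_ne_of_eq_succ {m : ℕ} {i i' j j' : Fin m} (h : (j' : ℕ) = j + 1) : (i, j) ≠ (i', j') :=
  fun e => by
    have : j = j' := congrArg Prod.snd e
    subst this
    omega

/-- Two vertical dominoes side by side can be replaced by two horizontal ones. -/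
theorem exists_flip_vertical {m : ℕ} (f : {f // IsPairing (squareLattice m) f}) {i i' j j' : Fin m}
    (hi : (i' : ℕ) = i + 1) (hj : (j' : ℕ) = j + 1) (h1 : f.1 (i, j) = (i', j))
    (h2 : f.1 (i, j') = (i', j')) :
    ∃ g : {f // IsPairing (squareLattice m) f}, IsFlip (kasteleynMatrix m) f g ∧
      g.1 (i, j) = (i, j') ∧ g.1 (i', j) = (i', j') ∧
      ∀ c, c ≠ (i, j) → c ≠ (i', j) → c ≠ (i, j') → c ≠ (i', j') → g.1 c = f.1 c :=
  exists_isFlip (kasteleynMatrix m) f h1 h2 (adj_horizontal i hj) (adj_horizontal i' hj)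
    (fst_ne_of_eq_succ hi) (fst_ne_of_eq_succ hi) (by
      -- Horizontal edges have weight 1, and adjacent columns have opposite signs.
      rw [kasteleynMatrix_horizontal _ hj, kasteleynMatrix_horizontal _ hj,
        kasteleynMatrix_vertical _ hi, kasteleynMatrix_vertical _ hi, hj, pow_succ, mul_neg_one, mul_neg,
        ← mul_pow]
      simp)

/-- Two horizontal dominoes above each other can be replaced by two vertical ones. -/
theorem exists_flip_horizontal {m : ℕ} (f : {f // IsPairing (squareLattice m) f}) {i i' j j' : Fin m}
    (hi : (i' : ℕ) = i + 1) (hj : (j' : ℕ) = j + 1) (h1 : f.1 (i, j) = (i, j'))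
    (h2 : f.1 (i', j) = (i', j')) :
    ∃ g : {f // IsPairing (squareLattice m) f}, IsFlip (kasteleynMatrix m) f g ∧
      g.1 (i, j) = (i', j) ∧ g.1 (i, j') = (i', j') ∧
      ∀ c, c ≠ (i, j) → c ≠ (i, j') → c ≠ (i', j) → c ≠ (i', j') → g.1 c = f.1 c :=
  exists_isFlip (kasteleynMatrix m) f h1 h2 (adj_vertical j hi) (adj_vertical j' hi)
    (snd_ne_of_eq_succ hj) (Ne.symm (fst_ne_of_eq_succ hi)) (by
      rw [kasteleynMatrix_horizontal _ hj, kasteleynMatrix_horizontal _ hj,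
        kasteleynMatrix_vertical _ hi, kasteleynMatrix_vertical _ hi, hj, pow_succ, mul_neg_one, mul_neg,
        ← mul_pow]
      simp)

theorem pairing_cases {m : ℕ} (f : {f // IsPairing (squareLattice m) f}) (i j : Fin m) :
    (∃ j' : Fin m, (j' : ℕ) = j + 1 ∧ f.1 (i, j) = (i, j')) ∨
    (∃ j' : Fin m, (j : ℕ) = j' + 1 ∧ f.1 (i, j) = (i, j')) ∨
    (∃ i' : Fin m, (i' : ℕ) = i + 1 ∧ f.1 (i, j) = (i', j)) ∨
    (∃ i' : Fin m, (i : ℕ) = i' + 1 ∧ f.1 (i, j) = (i', j)) := by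
  have h := (squareLattice_adj _ _).1 (f.2 (i, j)).1
  obtain ⟨⟨k, l⟩, hkl⟩ : ∃ p, p = f.1 (i, j) := ⟨_, rfl⟩
  rw [← hkl] at h ⊢
  dsimp only at h
  rcases h with ⟨rfl, h | h⟩ | ⟨rfl, h | h⟩
  · exact Or.inl ⟨l, h.symm, rfl⟩
  · exact Or.inr (Or.inl ⟨l, h.symm, rfl⟩)
  · exact Or.inr (Or.inr (Or.inl ⟨k, h.symm, rfl⟩))
  · exact Or.inr (Or.inr (Or.inr ⟨k, h.symm, rfl⟩))

theorem pairing_symm {m : ℕ} (f : {f // IsPairing (squareLattice m) f}) {p q : Fin m × Fin m}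
    (h : f.1 p = q) : f.1 q = p := by
  rw [← h, (f.2 p).2]

theorem exists_flip_of_two_vertical {m : ℕ} (f : {f // IsPairing (squareLattice m) f})
    {i i' j j' : Fin m} (hi : (i' : ℕ) = i + 1) (hj : (j' : ℕ) = j + 1) (h1 : f.1 (i, j) = (i', j))
    (h2 : f.1 (i, j') = (i', j')) : ∃ g : {f // IsPairing (squareLattice m) f},
      IsFlip (kasteleynMatrix m) f g ∧ g.1 (i, j) = (i, j') ∧
      ∀ c : Fin m × Fin m, (c.1 < i ∨ c.1 = i ∧ c.2 < j) → g.1 c = f.1 c := by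
  obtain ⟨g, hg, e1, -, e3⟩ := exists_flip_vertical f hi hj h1 h2
  refine ⟨g, hg, e1, fun c hc => e3 c ?_ ?_ ?_ ?_⟩ <;>
  · rintro rfl
    simp only [Fin.lt_def, Fin.ext_iff] at hc
    omega

/-- Flipping the horizontal pair puts a vertical domino beside the given one, and these two can then
be flipped. -/
theorem exists_flips_of_vertical_two_horizontal {m : ℕ} (f : {f // IsPairing (squareLattice m) f})
    {i i' j j' j'' : Fin m} (hi : (i' : ℕ) = i + 1) (hj : (j' : ℕ) = j + 1) (hj' : (j'' : ℕ) = j' + 1)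
    (h1 : f.1 (i, j) = (i', j)) (h2 : f.1 (i, j') = (i, j'')) (h3 : f.1 (i', j') = (i', j'')) :
    ∃ g : {f // IsPairing (squareLattice m) f},
      Relation.ReflTransGen (IsFlip (kasteleynMatrix m)) f g ∧ g.1 (i, j) = (i, j') ∧
      ∀ c : Fin m × Fin m, (c.1 < i ∨ c.1 = i ∧ c.2 < j) → g.1 c = f.1 c := by
  obtain ⟨f1, hf1, e1, -, e3⟩ := exists_flip_horizontal f hi hj' h2 h3
  have h4 : f1.1 (i, j) = (i', j) := by
    rw [e3, h1] <;> simp only [ne_eq, Prod.mk.injEq, Fin.ext_iff] <;> omega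
  obtain ⟨g, hg, k1, k2⟩ := exists_flip_of_two_vertical f1 hi hj h4 e1
  refine ⟨g, (Relation.ReflTransGen.single hf1).tail hg, k1, fun c hc => ?_⟩
  rw [k2 c hc]
  refine e3 c ?_ ?_ ?_ ?_ <;>
  · rintro rfl
    simp only [Fin.lt_def, Fin.ext_iff] at hc
    omega

/-- A vertical domino whose right neighbour is not covered from above can be made horizontal by
flips that do not touch the squares before it in reading order. -/
theorem exists_flips_making_horizontal {m : ℕ} (i i' j j' : Fin m) (hi : (i' : ℕ) = i + 1)
    (hj : (j' : ℕ) = j + 1) (f : {f // IsPairing (squareLattice m) f}) (h1 : f.1 (i, j) = (i', j))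
    (h2 : i ≤ (f.1 (i, j')).1) :
    ∃ g : {f // IsPairing (squareLattice m) f},
      Relation.ReflTransGen (IsFlip (kasteleynMatrix m)) f g ∧ g.1 (i, j) = (i, j') ∧
      ∀ c : Fin m × Fin m, (c.1 < i ∨ c.1 = i ∧ c.2 < j) → g.1 c = f.1 c := by
  -- Induction on the number of rows from `i` to the bottom: an obstruction has the same shape one
  -- row lower and one column to the right.
  obtain ⟨N, hN⟩ : ∃ N, N = m - (i : ℕ) := ⟨_, rfl⟩
  induction N using Nat.strong_induction_on generalizing i i' j j' f with
  | _ N ih =>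
    rcases pairing_cases f i j' with ⟨j'', hj', h3⟩ | ⟨l, hl, h3⟩ | ⟨k, hk, h3⟩ | ⟨k, hk, h3⟩
    · rcases pairing_cases f i' j' with ⟨l, hl, h4⟩ | ⟨l, hl, h4⟩ | ⟨i'', hi', h4⟩ | ⟨k, hk, h4⟩
      · obtain rfl : l = j'' := Fin.ext (by omega)
        exact exists_flips_of_vertical_two_horizontal f hi hj hj' h1 h3 h4
      · obtain rfl : l = j := Fin.ext (by omega)
        have := (pairing_symm f h4).symm.trans (pairing_symm f h1)
        simp only [Prod.mk.injEq, Fin.ext_iff] at this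
        omega
      -- The square `(i, j'')` is matched with `(i, j')`, so `(i', j'')` is not covered from above
      -- and the induction hypothesis applies to the vertical domino at `(i', j')`.
      · have h5 : i' ≤ (f.1 (i', j'')).1 := by
          rcases pairing_cases f i' j'' with ⟨l, hl, h6⟩ | ⟨l, hl, h6⟩ | ⟨k, hk, h6⟩ | ⟨k, hk, h6⟩
          · rw [h6]
          · rw [h6]
          · rw [h6, Fin.le_def]; dsimp only; omega
          · obtain rfl : k = i := Fin.ext (by omega)
            have := (pairing_symm f h6).symm.trans (pairing_symm f h3)
            simp only [Prod.mk.injEq, Fin.ext_iff] at this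
            omega
        obtain ⟨g, hg, e1, e2⟩ := ih (m - i') (by omega) i' i'' j' j'' hi' hj' f h4 h5 rfl
        have hrow : ∀ l : Fin m, g.1 (i, l) = f.1 (i, l) := fun l =>
          e2 (i, l) (Or.inl (by rw [Fin.lt_def]; dsimp only; omega))
        obtain ⟨g', hg', k1, k2⟩ := exists_flips_of_vertical_two_horizontal g hi hj hj'
          ((hrow j).trans h1) ((hrow j').trans h3) e1
        refine ⟨g', hg.trans hg', k1, fun c hc => (k2 c hc).trans (e2 c (Or.inl ?_))⟩
        simp only [Fin.lt_def, Fin.ext_iff] at hc ⊢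
        omega
      · obtain rfl : k = i := Fin.ext (by omega)
        have := (pairing_symm f h4).symm.trans h3
        simp only [Prod.mk.injEq, Fin.ext_iff] at this
        omega
    · obtain rfl : l = j := Fin.ext (by omega)
      have := (pairing_symm f h3).symm.trans h1
      simp only [Prod.mk.injEq, Fin.ext_iff] at this
      omega
    · obtain rfl : k = i' := Fin.ext (by omega)
      obtain ⟨g, hg, k1, k2⟩ := exists_flip_of_two_vertical f hi hj h1 h3
      exact ⟨g, Relation.ReflTransGen.single hg, k1, k2⟩
    · rw [h3, Fin.le_def] at h2
      dsimp only at h2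
      omega

/-- The squares before row `i`, column `j` in reading order are covered by horizontal dominoes
whose left squares lie in columns of even index. -/
def IsHorizontalBefore {m : ℕ} (f : {f // IsPairing (squareLattice m) f}) (i j : ℕ) : Prop :=
  ∀ c : Fin m × Fin m, ((c.1 : ℕ) < i ∨ (c.1 : ℕ) = i ∧ (c.2 : ℕ) < j) →
    (f.1 c).1 = c.1 ∧ (Even (c.2 : ℕ) → ((f.1 c).2 : ℕ) = c.2 + 1) ∧
      (Odd (c.2 : ℕ) → ((f.1 c).2 : ℕ) + 1 = c.2)

/-- In an odd column the square is already covered from the left. In an even column the earlier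
squares rule out dominoes going left or up, and one going down is turned; evenness of `m` leaves
room on its right. -/
theorem exists_isHorizontalBefore_succ {m : ℕ} (hm : Even m) (f : {f // IsPairing (squareLattice m) f})
    (i j : Fin m) (hf : IsHorizontalBefore f i j) :
    ∃ g : {f // IsPairing (squareLattice m) f},
      Relation.ReflTransGen (IsFlip (kasteleynMatrix m)) f g ∧ IsHorizontalBefore g i (j + 1) := by
  have extend : ∀ g : {f // IsPairing (squareLattice m) f}, IsHorizontalBefore g i j →
      ((g.1 (i, j)).1 = i ∧ (Even (j : ℕ) → ((g.1 (i, j)).2 : ℕ) = j + 1) ∧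
      (Odd (j : ℕ) → ((g.1 (i, j)).2 : ℕ) + 1 = j)) → IsHorizontalBefore g i (j + 1) := by
    intro g hg h c hc
    by_cases hcj : c = (i, j)
    · rw [hcj]; exact h
    · refine hg c ?_
      rw [Prod.ext_iff, Fin.ext_iff, Fin.ext_iff] at hcj
      dsimp only at hcj
      omega
  rcases Nat.even_or_odd (j : ℕ) with hj | hj
  · have hne : ¬ Odd (j : ℕ) := Nat.not_odd_iff_even.2 hj
    have hj' : (j : ℕ) + 1 < m := by
      have := j.2
      rcases hm with ⟨a, ha⟩
      rcases hj with ⟨b, hb⟩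
      omega
    rcases pairing_cases f i j with ⟨l, hl, h⟩ | ⟨l, hl, h⟩ | ⟨k, hk, h⟩ | ⟨k, hk, h⟩
    · exact ⟨f, Relation.ReflTransGen.refl, extend f hf (by
        rw [h]; exact ⟨rfl, fun _ => hl, fun h => absurd h hne⟩)⟩
    · have h1 := hf (i, l) (Or.inr ⟨rfl, by dsimp only; omega⟩)
      rw [pairing_symm f h] at h1
      have hodd : Odd (l : ℕ) := by
        rw [hl] at hj
        exact Nat.not_even_iff_odd.1 (Nat.even_add_one.1 hj)
      have h2 := h1.2.2 hodd
      dsimp only at h2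
      omega
    · obtain ⟨g, hg, e1, e2⟩ := exists_flips_making_horizontal i k j ⟨j + 1, hj'⟩ hk rfl f h (by
        rcases pairing_cases f i ⟨j + 1, hj'⟩ with ⟨l, hl, h6⟩ | ⟨l, hl, h6⟩ | ⟨k, hk, h6⟩ | ⟨k, hk, h6⟩
        · rw [h6]
        · rw [h6]
        · rw [h6, Fin.le_def]; dsimp only; omega
        · have h1 := (hf (k, ⟨j + 1, hj'⟩) (Or.inl (by dsimp only; omega))).1
          rw [pairing_symm f h6, Fin.ext_iff] at h1
          dsimp only at h1
          omega)
      refine ⟨g, hg, extend g (fun c hc => ?_) ?_⟩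
      · rw [e2 c (by rw [Fin.lt_def, Fin.lt_def, Fin.ext_iff]; exact hc)]
        exact hf c hc
      · rw [e1]
        exact ⟨rfl, fun _ => rfl, fun h => absurd h hne⟩
    · have h1 := (hf (k, j) (Or.inl (by dsimp only; omega))).1
      rw [pairing_symm f h, Fin.ext_iff] at h1
      dsimp only at h1
      omega
  · refine ⟨f, Relation.ReflTransGen.refl, extend f hf ?_⟩
    have hpos : 0 < (j : ℕ) := hj.pos
    have heven : Even ((j : ℕ) - 1) := Nat.Odd.sub_odd hj odd_one
    have h1 := hf (i, ⟨j - 1, by omega⟩) (Or.inr ⟨rfl, by dsimp only; omega⟩)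
    have h2 := h1.2.1 heven
    have h3 : f.1 (i, ⟨j - 1, by omega⟩) = (i, j) := Prod.ext h1.1 (Fin.ext (by
      dsimp only at h2 ⊢; omega))
    rw [pairing_symm f h3]
    refine ⟨rfl, fun h => absurd hj (Nat.not_odd_iff_even.2 h), fun _ => ?_⟩
    dsimp only
    omega

theorem exists_isHorizontalBefore {m : ℕ} (hm : Even m) (f : {f // IsPairing (squareLattice m) f}) :
    ∃ g : {f // IsPairing (squareLattice m) f},
      Relation.ReflTransGen (IsFlip (kasteleynMatrix m)) f g ∧ IsHorizontalBefore g m 0 := by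
  have hrows : ∀ i ≤ m, ∃ g : {f // IsPairing (squareLattice m) f},
      Relation.ReflTransGen (IsFlip (kasteleynMatrix m)) f g ∧ IsHorizontalBefore g i 0 := by
    intro i
    induction i with
    | zero => exact fun _ => ⟨f, Relation.ReflTransGen.refl, fun c hc => by omega⟩
    | succ i ih =>
      intro hi
      have hcols : ∀ j ≤ m, ∃ g : {f // IsPairing (squareLattice m) f},
          Relation.ReflTransGen (IsFlip (kasteleynMatrix m)) f g ∧ IsHorizontalBefore g i j := by
        intro j
        induction j with
        | zero => exact fun _ => ih (by omega)
        | succ j ihj =>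
          intro hj
          obtain ⟨g, hg, hg'⟩ := ihj (by omega)
          obtain ⟨g1, h1, h2⟩ := exists_isHorizontalBefore_succ hm g ⟨i, hi⟩ ⟨j, hj⟩ hg'
          exact ⟨g1, hg.trans h1, h2⟩
      obtain ⟨g, hg, hg'⟩ := hcols m le_rfl
      exact ⟨g, hg, fun c hc => hg' c (by have := c.2.2; omega)⟩
  exact hrows m le_rfl

/-- Both matchings reach the all-horizontal one, which `IsHorizontalBefore` determines uniquely. -/
theorem join_flips {m : ℕ} (hm : Even m) (f f' : {f // IsPairing (squareLattice m) f}) :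
    Relation.Join (Relation.ReflTransGen (IsFlip (kasteleynMatrix m))) f f' := by
  obtain ⟨g, hg, h1⟩ := exists_isHorizontalBefore hm f
  obtain ⟨g', hg', h2⟩ := exists_isHorizontalBefore hm f'
  have : g = g' := by
    refine Subtype.ext (Equiv.ext fun c => ?_)
    have k1 := h1 c (Or.inl c.1.2)
    have k2 := h2 c (Or.inl c.1.2)
    refine Prod.ext (k1.1.trans k2.1.symm) (Fin.ext ?_)
    rcases Nat.even_or_odd (c.2 : ℕ) with h | h
    · rw [k1.2.1 h, k2.2.1 h]
    · have := k1.2.2 h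
      have := k2.2.2 h
      omega
  subst this
  exact ⟨g, hg, hg'⟩

/-! ### Kasteleyn's theorem and the conclusion -/

/-- Kasteleyn's theorem for the square board of even side. -/
theorem abs_det_kasteleynMatrix_eq_tilingCount_sq (n : ℕ) :
    |(kasteleynMatrix (2 * n)).det| = (tilingCount n : ℝ) ^ 2 := by
  rw [tilingCount, ncard_isPerfectMatching_eq]
  refine abs_det_eq_card_pairings_sq (M := kasteleynMatrix (2 * n))
    (fun c => decide (((c.1 : ℕ) + c.2) % 2 = 0)) ?_ kasteleynMatrix_symm
    kasteleynMatrix_eq_zero abs_kasteleynMatrix (join_flips (even_two_mul n))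
  rintro ⟨i, j⟩ ⟨k, l⟩ h
  rw [squareLattice_adj] at h
  simp only [Fin.ext_iff] at h
  intro h'
  have h'' := decide_eq_decide.1 h'
  dsimp only at h''
  omega

theorem tilingCount_eq (n : ℕ) : (tilingCount n : ℝ) = 2 ^ n * chordProduct n ^ 2 := by
  refine (pow_left_inj₀ (Nat.cast_nonneg _) (by positivity) two_ne_zero).1 ?_
  rw [← abs_det_kasteleynMatrix_eq_tilingCount_sq, abs_det_kasteleynMatrix]

theorem theoremA :
    ∃ B : ℕ → ℤ,
      (∀ n : ℕ, 1 ≤ n → 0 < B n ∧ (tilingCount n : ℤ) = 2 ^ n * B n ^ 2) ∧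
      (∀ r : ℕ, r ≤ 5 → CongruenceStatement B r) ∧
      (∀ r : ℕ, 6 ≤ r → ¬ CongruenceStatement B r) ∧
      B 3 = 29 := by
  choose B hB heven hodd using exists_int_eq_chordProduct
  have h3 : B 3 = 29 := by
    have := (hB 3).trans chordProduct_three
    exact_mod_cast this
  refine ⟨B, fun n _ => ⟨?_, ?_⟩, ?_, ?_, h3⟩
  · have := chordProduct_pos n
    rw [← hB] at this
    exact_mod_cast this
  · have := tilingCount_eq n
    rw [← hB] at this
    exact_mod_cast this
  · intro r hr n _
    have hdvd : (2 ^ r : ℤ) ∣ 32 := by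
      rw [show (32 : ℤ) = 2 ^ 5 by norm_num]
      exact pow_dvd_pow 2 hr
    exact ⟨fun h => (heven n h).of_dvd hdvd, fun h => (hodd n h).of_dvd hdvd⟩
  · intro r hr h
    -- For `r ≥ 6` the statement at `n = 3` would give `29 ≡ -3` modulo 64.
    have h1 := ((h 3 (by norm_num)).2 (by decide)).of_dvd (pow_dvd_pow (2 : ℤ) hr)
    rw [h3] at h1
    exact absurd h1 (by decide)
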